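/- Let $(M,g)$ be a smooth, complete (connected) Riemannian manifold of dimension $n\ge 2$, with Riemannian measure $\mu$ (in any chart $d\mu=\sqrt{\det(g_{ij})}\,dm$, $dm$ the Lebesgue measure); all norms below are $L^r(M,\mu)$ norms. Let $1\le p<n$, $q=\frac{np}{n-p}$, $0<\alpha\le 1$ and $A>0$. Let $W^{1,p}(M)$ be the completion of the space of functions $\varphi\in C^\infty(M)$ with $\|\varphi\|_p+\|\nabla\varphi\|_p<\infty$ under this norm and, for $\Omega\subseteq M$ open, let $W^{1,p}_0(\Omega)$ be the closure of $C_c^\infty(\Omega)$ in it (functions on $\Omega$ being extended by zero). Suppose that there are $\tau>0$ and $B\ge 0$ such that for every open set $\Omega\subseteq M$ with $\mu(\Omega)\le\tau$ $$\|u\|_q^\alpha\le A\|\nabla u\|_p^\alpha+B\|u\|_p^\alpha\qquad\text{for all } u\in W^{1,p}_0(\Omega).$$ Then there is $B'\ge 0$ such that, with the same constant $A$, $$\|u\|_q^\alpha\le A\|\nabla u\|_p^\alpha+B'\|u\|_p^\alpha\qquad\text{for all } u\in W^{1,p}(M).$$ -/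

import Mathlib

open scoped Manifold ContDiff Bundle Topology ENNReal

noncomputable section

namespace RiemannianSobolev

variable {n : ℕ} {M : Type*} [MetricSpace M] [ChartedSpace (EuclideanSpace ℝ (Fin n)) M]
  [Bundle.RiemannianBundle (fun x : M ↦ TangentSpace (𝓡 n) x)]

/-- The `i`-th coordinate vector field `∂ᵢ` of the chart at `x`, at the point of the manifold whose
coordinates are `y`. -/
def coordVector (x : M) (y : EuclideanSpace ℝ (Fin n)) (i : Fin n) :
    TangentSpace (𝓡 n) ((chartAt (EuclideanSpace ℝ (Fin n)) x).symm y) :=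
  mfderiv (𝓡 n) (𝓡 n) (chartAt (EuclideanSpace ℝ (Fin n)) x).symm y
    (EuclideanSpace.single i (1 : ℝ) : EuclideanSpace ℝ (Fin n))

/-- The matrix `g_{ij} = g(∂ᵢ, ∂ⱼ)` of the metric in the chart at `x`, as a function of the
coordinates. -/
def metricMatrix (x : M) (y : EuclideanSpace ℝ (Fin n)) : Matrix (Fin n) (Fin n) ℝ :=
  Matrix.of fun i j ↦ inner ℝ (coordVector x y i) (coordVector x y j)

/-- The measure `√(det g_{ij}) dm` on the domain of the chart at `x`, seen as a measure on `M` that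
vanishes off that domain. -/
def chartVolume [MeasurableSpace M] (x : M) : MeasureTheory.Measure M :=
  ((MeasureTheory.volume.restrict (chartAt (EuclideanSpace ℝ (Fin n)) x).target).withDensity
    (fun y ↦ ENNReal.ofReal (Real.sqrt (metricMatrix x y).det))).map
    (chartAt (EuclideanSpace ℝ (Fin n)) x).symm

variable (n M) in
/-- The Riemannian measure. By the change of variables formula, the measures `chartVolume x` agree
on the overlaps of the charts; their supremum (in the complete lattice of measures) is the measure
that restricts to `√(det g_{ij}) dm` on the domain of each chart. -/
def riemannianVolume [MeasurableSpace M] : MeasureTheory.Measure M :=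
  ⨆ x : M, chartVolume (n := n) x

/-- The differential of `φ` at `x`, that is, the gradient of `φ` as a covector. -/
def differential (φ : M → ℝ) (x : M) : TangentSpace (𝓡 n) x →L[ℝ] ℝ :=
  mfderiv (𝓡 n) 𝓘(ℝ, ℝ) φ x

/-- The length of a covector: its operator norm for the Riemannian norm on the tangent space. The
length of the differential of a function is the length of its gradient. -/
def covectorNorm {x : M} (ξ : TangentSpace (𝓡 n) x →L[ℝ] ℝ) : ℝ := ‖ξ‖

/-- `IsSobolevLimit S p u X`: the pair formed by the function `u` and the field of covectors `X`
(the differential of `u`) is a limit, for the norm `‖u‖_p + ‖∇u‖_p`, of smooth functions that belong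
to the class `S`. -/
def IsSobolevLimit [MeasurableSpace M] (S : Set (M → ℝ)) (p : ℝ) (u : M → ℝ)
    (X : (x : M) → TangentSpace (𝓡 n) x →L[ℝ] ℝ) : Prop :=
  MeasureTheory.AEStronglyMeasurable u (riemannianVolume n M) ∧
  ∃ φ : ℕ → M → ℝ,
    (∀ j, φ j ∈ S) ∧
    (∀ j, ContMDiff (𝓡 n) 𝓘(ℝ, ℝ) ∞ (φ j)) ∧
    (∀ j, MeasureTheory.AEStronglyMeasurable (fun x ↦ covectorNorm (X x - differential (φ j) x))
      (riemannianVolume n M)) ∧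
    Filter.Tendsto (fun j ↦ MeasureTheory.eLpNorm (fun x ↦ u x - φ j x) (ENNReal.ofReal p)
      (riemannianVolume n M)) Filter.atTop (𝓝 0) ∧
    Filter.Tendsto (fun j ↦ MeasureTheory.eLpNorm
      (fun x ↦ covectorNorm (X x - differential (φ j) x)) (ENNReal.ofReal p) (riemannianVolume n M)) Filter.atTop (𝓝 0)

/-- `u` belongs to `W^{1,p}(M)`, the completion of the space of smooth functions `φ` with
`‖φ‖_p + ‖∇φ‖_p < ∞`, and its differential is `X`. -/
def MemW [MeasurableSpace M] (p : ℝ) (u : M → ℝ)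
    (X : (x : M) → TangentSpace (𝓡 n) x →L[ℝ] ℝ) : Prop :=
  IsSobolevLimit
    {φ | MeasureTheory.MemLp φ (ENNReal.ofReal p) (riemannianVolume n M) ∧
      MeasureTheory.MemLp (fun x ↦ covectorNorm (differential (n := n) φ x)) (ENNReal.ofReal p)
        (riemannianVolume n M)} p u X

/-- `u` belongs to `W_0^{1,p}(Ω)`, the closure of `C_c^∞(Ω)`, and its differential is `X`; functions
on `Ω` are extended by zero. -/
def MemW₀ [MeasurableSpace M] (Ω : Set M) (p : ℝ) (u : M → ℝ)
    (X : (x : M) → TangentSpace (𝓡 n) x →L[ℝ] ℝ) : Prop :=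
  IsSobolevLimit {φ | HasCompactSupport φ ∧ tsupport φ ⊆ Ω} p u X

/-- `‖u‖_q^α ≤ A ‖∇u‖_p^α + B ‖u‖_p^α`, where `X` is the differential of `u`. -/
def SobolevInequality [MeasurableSpace M] (p q α A B : ℝ) (u : M → ℝ)
    (X : (x : M) → TangentSpace (𝓡 n) x →L[ℝ] ℝ) : Prop :=
  MeasureTheory.eLpNorm u (ENNReal.ofReal q) (riemannianVolume n M) ^ α ≤
    ENNReal.ofReal A *
      MeasureTheory.eLpNorm (fun x ↦ covectorNorm (X x)) (ENNReal.ofReal p)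
        (riemannianVolume n M) ^ α +
    ENNReal.ofReal B *
      MeasureTheory.eLpNorm u (ENNReal.ofReal p) (riemannianVolume n M) ^ α

variable (n M) in
/-- The Sobolev inequality with constant `A` holds for small volumes on `M`. -/
def SobolevForSmallVolumes [MeasurableSpace M] (p q α A : ℝ) : Prop :=
  ∃ τ > 0, ∃ B ≥ 0, ∀ Ω : Set M, IsOpen Ω → riemannianVolume n M Ω ≤ ENNReal.ofReal τ →
    ∀ (u : M → ℝ) (X : (x : M) → TangentSpace (𝓡 n) x →L[ℝ] ℝ),
      MemW₀ Ω p u X → SobolevInequality p q α A B u X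

variable (n M) in
/-- The Sobolev inequality with constant `A` holds globally on `M`. -/
def SobolevGlobally [MeasurableSpace M] (p q α A : ℝ) : Prop :=
  ∃ B ≥ 0, ∀ (u : M → ℝ) (X : (x : M) → TangentSpace (𝓡 n) x →L[ℝ] ℝ),
    MemW p u X → SobolevInequality p q α A B u X

end RiemannianSobolev

end

/-! The large values of a function live on a set of small volume, and the small values cost only the
`p`-norm. Let `φ` be smooth with compact support, `N = ‖φ‖_p` and `t = τ^(-1/p) N`. By Markov's
inequality, `{|φ| > t}` is open of volume at most `τ`. A smooth truncation `ψ` with `|ψ'| ≤ 1`, zero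
on `[-2t, 2t]`, gives a function `ψ ∘ φ` supported in that set, and the hypothesis applies to it
without enlarging the gradient. The remainder `φ - ψ ∘ φ` is bounded by `|φ|` and by `3t`, so
interpolation between `L^p` and `L^∞` bounds its `q`-norm by `(3 τ^(-1/p))^((q-p)/q) N`. Since `α ≤
1`, the power `α` is subadditive: the two pieces add up with no factor in front of `A`, and the
remainder only increases `B`. This is `sobolevInequality_of_hasCompactSupport`.

The passage to `W^{1,p}(M)` multiplies by cutoffs whose differential tends to zero uniformly, then
uses density, with Fatou's lemma for the `q`-norm each time. The cutoffs (`exists_cutoff`) are where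
completeness enters: closed balls are compact, so a truncated distance function has compact support.
It is `1`-Lipschitz but not smooth, so it is mollified in charts and the pieces are glued by a
partition of unity, keeping an absolute bound on the differential. -/

noncomputable section

namespace RiemannianSobolev

open Set Metric

/-! ### Compactness of closed balls (Hopf–Rinow) -/

/-- In a metric space in which any two points can be almost split at every intermediate distance,
local compactness and completeness imply that closed balls are compact. -/
theorem properSpace_of_exists_dist_le {X : Type*} [MetricSpace X] [CompleteSpace X]
    [LocallyCompactSpace X]
    (hX : ∀ (x y : X) (r s : ℝ), 0 ≤ r → dist x y < r + s → 0 < s →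
      ∃ z, dist x z ≤ r ∧ dist z y < s) : ProperSpace X := by
  refine ⟨fun x ↦ ?_⟩
  by_contra! hne
  obtain ⟨r₀, hr₀⟩ := hne
  set S : Set ℝ := {r | 0 ≤ r ∧ IsCompact (closedBall x r)} with hS
  have mono : ∀ r s, r ≤ s → IsCompact (closedBall x s) → IsCompact (closedBall x r) :=
    fun r s hrs hs ↦ hs.of_isClosed_subset isClosed_closedBall (closedBall_subset_closedBall hrs)
  have h0 : (0 : ℝ) ∈ S := ⟨le_rfl, by simp⟩
  have hbdd : BddAbove S := by
    refine ⟨r₀, fun r hr ↦ ?_⟩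
    by_contra! h
    exact hr₀ (mono _ _ h.le hr.2)
  set R := sSup S with hR
  have hR0 : 0 ≤ R := le_csSup hbdd h0
  have hlt : ∀ r, r < R → IsCompact (closedBall x r) := by
    intro r hr
    obtain ⟨s, hs, hrs⟩ := exists_lt_of_lt_csSup ⟨0, h0⟩ hr
    exact mono _ _ hrs.le hs.2
  have hRc : IsCompact (closedBall x R) := by
    rcases hR0.eq_or_lt with h | hRpos
    · rw [← h]; simp
    rw [isCompact_iff_totallyBounded_isComplete]
    refine ⟨?_, isClosed_closedBall.isComplete⟩
    rw [Metric.totallyBounded_iff]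
    intro ε hε
    -- Points of the ball of radius `R` lie within `2δ ≤ ε / 2` of the compact ball of radius `R -
    -- δ`, so an `ε / 2`-net of the latter suffices. The bound `δ ≤ R / 2` keeps `R - δ`
    -- nonnegative.
    set δ := min (ε / 4) (R / 2) with hδ
    have hδpos : 0 < δ := by positivity
    obtain ⟨t, ht, htc⟩ := Metric.totallyBounded_iff.1 (hlt (R - δ) (by linarith)).totallyBounded
      (ε / 2) (by positivity)
    refine ⟨t, ht, fun y hy ↦ ?_⟩
    have hy' : dist x y ≤ R := by rw [dist_comm]; exact hy
    have h1 : δ ≤ R / 2 := min_le_right _ _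
    have h2 : δ ≤ ε / 4 := min_le_left _ _
    obtain ⟨z, hz1, hz2⟩ := hX x y (R - δ) (2 * δ) (by linarith) (by linarith) (by linarith)
    have hz : z ∈ closedBall x (R - δ) := by rw [mem_closedBall, dist_comm]; exact hz1
    obtain ⟨w, hw, hzw⟩ := mem_iUnion₂.1 (htc hz)
    refine mem_iUnion₂.2 ⟨w, hw, ?_⟩
    rw [mem_ball] at hzw ⊢
    calc dist y w ≤ dist y z + dist z w := dist_triangle _ _ _
      _ < ε := by rw [dist_comm y z]; linarith
  -- Local compactness pushes past the supremum: a compact neighbourhood of the ball of radius `R`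
  -- contains its `δ`-thickening, hence the ball of radius `R + δ / 2`.
  obtain ⟨K, hK, hKs⟩ := exists_compact_superset hRc
  obtain ⟨δ, hδ, hδK⟩ := hRc.exists_thickening_subset_open isOpen_interior hKs
  have hmem : R + δ / 2 ∈ S := by
    refine ⟨by positivity, hK.of_isClosed_subset isClosed_closedBall fun y hy ↦ ?_⟩
    have hy' : dist x y ≤ R + δ / 2 := by rw [dist_comm]; exact hy
    obtain ⟨z, hz1, hz2⟩ := hX x y R δ hR0 (by linarith) hδ
    refine interior_subset (hδK (mem_thickening_iff.2 ⟨z, ?_, ?_⟩))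
    · rw [mem_closedBall, dist_comm]; exact hz1
    · rwa [dist_comm]
  have := le_csSup hbdd hmem
  linarith

section

variable {E : Type*} [NormedAddCommGroup E] [NormedSpace ℝ E]
  {H : Type*} [TopologicalSpace H] (I : ModelWithCorners ℝ E H)
  {M : Type*} [MetricSpace M] [ChartedSpace H M]
  [Bundle.RiemannianBundle (fun x : M ↦ TangentSpace I x)]

/-- A point at distance less than `r + s` from `x` is at distance less than `s` from a point at
distance at most `r` from `x`, as one sees by moving along a short path. -/
theorem exists_dist_le_dist_lt [IsRiemannianManifold I M] (x y : M) (r s : ℝ) (hr : 0 ≤ r)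
    (hxy : dist x y < r + s) (hs : 0 < s) : ∃ z, dist x z ≤ r ∧ dist z y < s := by
  rcases le_or_gt (dist x y) r with h | h
  · exact ⟨y, h, by simpa⟩
  have hlt : Manifold.riemannianEDist I x y < ENNReal.ofReal (r + s) := by
    rw [← IsRiemannianManifold.out (I := I) x y, edist_dist]
    exact (ENNReal.ofReal_lt_ofReal_iff (by linarith)).2 hxy
  obtain ⟨γ, h0, h1, hγ, hlen⟩ := Manifold.exists_lt_of_riemannianEDist_lt hlt
  have hcont : ContinuousOn (fun t ↦ dist x (γ t)) (Icc 0 1) :=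
    continuous_dist.comp_continuousOn (continuousOn_const.prodMk hγ.continuousOn)
  -- The path is cut at a point at distance exactly `r` from `x`: the part before it has length at
  -- least `r`, which leaves less than `s` for the rest.
  obtain ⟨t, ht, htr⟩ : r ∈ (fun t ↦ dist x (γ t)) '' Icc 0 1 :=
    intermediate_value_Icc zero_le_one hcont ⟨by simpa [h0], by simpa [h1] using h.le⟩
  refine ⟨γ t, htr.le, ?_⟩
  have e1 : edist x (γ t) ≤ Manifold.pathELength I γ 0 t := by
    rw [IsRiemannianManifold.out (I := I)]
    exact Manifold.riemannianEDist_le_pathELength (hγ.mono (Icc_subset_Icc_right ht.2)) h0 rfl ht.1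
  have e2 : edist (γ t) y ≤ Manifold.pathELength I γ t 1 := by
    rw [IsRiemannianManifold.out (I := I)]
    exact Manifold.riemannianEDist_le_pathELength (hγ.mono (Icc_subset_Icc_left ht.1)) rfl h1 ht.2
  have e3 : edist x (γ t) + edist (γ t) y < ENNReal.ofReal (r + s) :=
    (add_le_add e1 e2).trans_lt (by rwa [Manifold.pathELength_add ht.1 ht.2])
  rw [edist_dist, edist_dist, ← ENNReal.ofReal_add dist_nonneg dist_nonneg,
    ENNReal.ofReal_lt_ofReal_iff (by linarith)] at e3
  have htr' : dist x (γ t) = r := htr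
  linarith

variable (M) in
/-- Closed balls of a complete Riemannian manifold are compact (Hopf–Rinow). -/
theorem properSpace_of_completeSpace [IsRiemannianManifold I M] [CompleteSpace M]
    [LocallyCompactSpace M] : ProperSpace M :=
  properSpace_of_exists_dist_le (exists_dist_le_dist_lt I)

end

/-! ### Mollification of Lipschitz functions -/

section

open MeasureTheory

/-- A Lipschitz function on a finite-dimensional normed space is a uniform limit of smooth
functions with the same Lipschitz constant. -/
theorem exists_contDiff_dist_le_norm_fderiv_le {F : Type*} [NormedAddCommGroup F]
    [NormedSpace ℝ F] [FiniteDimensional ℝ F] {C : NNReal} {g : F → ℝ} (hg : LipschitzWith C g)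
    {δ : ℝ} (hδ : 0 < δ) :
    ∃ G : F → ℝ, ContDiff ℝ ∞ G ∧ (∀ v, |G v - g v| ≤ δ) ∧ ∀ v, ‖fderiv ℝ G v‖ ≤ C := by
  let _ : MeasurableSpace F := borel F
  have : BorelSpace F := ⟨rfl⟩
  let μ : Measure F := Measure.addHaar
  -- The `+ 1` covers `C = 0`; at this radius `g` oscillates by at most `C * r ≤ δ`.
  let r : ℝ := δ / (C + 1)
  have hr : 0 < r := by positivity
  let φ : ContDiffBump (0 : F) := ⟨r / 2, r, by positivity, by linarith⟩
  let G : F → ℝ := MeasureTheory.convolution (φ.normed μ) g (ContinuousLinearMap.lsmul ℝ ℝ) μ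
  have hGdef : ∀ v, G v = ∫ t, φ.normed μ t * g (v - t) ∂μ := fun v ↦ rfl
  have hint : ∀ v, Integrable (fun t ↦ φ.normed μ t * g (v - t)) μ := by
    intro v
    refine Continuous.integrable_of_hasCompactSupport ?_ ?_
    · exact φ.continuous_normed.mul (hg.continuous.comp (continuous_const.sub continuous_id))
    · exact (φ.hasCompactSupport_normed (μ := μ)).mul_right
  refine ⟨G, ?_, fun v ↦ ?_, fun v ↦ ?_⟩
  · exact φ.hasCompactSupport_normed.contDiff_convolution_left _ φ.contDiff_normed
      (hg.continuous.locallyIntegrable)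
  · have := φ.dist_normed_convolution_le (μ := μ) (g := g) (x₀ := v) (ε := δ)
      hg.continuous.aestronglyMeasurable ?_
    · simpa [Real.dist_eq] using this
    intro w hw
    calc dist (g w) (g v) ≤ C * dist w v := hg.dist_le_mul _ _
      _ ≤ (C + 1) * r := by
        have : dist w v ≤ r := (mem_ball.1 hw).le
        gcongr
        linarith
      _ = δ := by simp only [r]; field_simp
  · refine norm_fderiv_le_of_lipschitz ℝ (LipschitzWith.of_dist_le_mul fun v w ↦ ?_)
    rw [Real.dist_eq, hGdef, hGdef, ← integral_sub (hint v) (hint w)]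
    calc |∫ t, φ.normed μ t * g (v - t) - φ.normed μ t * g (w - t) ∂μ|
        ≤ ∫ t, φ.normed μ t * (C * dist v w) ∂μ := by
          have hb : Integrable (fun t ↦ φ.normed μ t * (C * dist v w)) μ :=
            φ.integrable_normed.mul_const _
          rw [← Real.norm_eq_abs]
          refine norm_integral_le_of_norm_le hb (Filter.Eventually.of_forall fun t ↦ ?_)
          rw [← mul_sub, norm_mul, Real.norm_of_nonneg (φ.nonneg_normed t)]
          refine mul_le_mul_of_nonneg_left ?_ (φ.nonneg_normed t)
          have := hg.dist_le_mul (v - t) (w - t)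
          rwa [dist_sub_right, Real.dist_eq] at this
      _ = C * dist v w := by rw [integral_mul_const, φ.integral_normed, one_mul]

end

/-! ### The Riemannian metric in a chart -/

section

variable {E : Type*} [NormedAddCommGroup E] [NormedSpace ℝ E]
  {M : Type*} [MetricSpace M] [ChartedSpace E M] [IsManifold 𝓘(ℝ, E) ∞ M]
  [Bundle.RiemannianBundle (fun x : M ↦ TangentSpace 𝓘(ℝ, E) x)]

theorem isContinuousRiemannianBundle_of_isContMDiffRiemannianBundle
    [h : IsContMDiffRiemannianBundle 𝓘(ℝ, E) ∞ E (fun x : M ↦ TangentSpace 𝓘(ℝ, E) x)] :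
    IsContinuousRiemannianBundle E (fun x : M ↦ TangentSpace 𝓘(ℝ, E) x) := by
  obtain ⟨g, hg, hg'⟩ := h.exists_contMDiff
  exact ⟨g, hg.continuous, hg'⟩

/-- Near `x`, the metric read in the chart at `x` is within a factor `2` of the norm of the tangent
space at `x`. -/
theorem exists_tangentSpace_equiv_norm_le
    [IsContinuousRiemannianBundle E (fun x : M ↦ TangentSpace 𝓘(ℝ, E) x)] (x : M) :
    ∃ L : TangentSpace 𝓘(ℝ, E) x ≃L[ℝ] E,
      (∀ᶠ y in 𝓝 x, ∀ w : TangentSpace 𝓘(ℝ, E) y,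
        ‖L.symm (mfderiv 𝓘(ℝ, E) 𝓘(ℝ, E) (extChartAt 𝓘(ℝ, E) x) y w)‖ ≤ 2 * ‖w‖) ∧
      (∀ᶠ y in 𝓝 (extChartAt 𝓘(ℝ, E) x x), ∀ v : TangentSpace 𝓘(ℝ, E) x,
        ‖mfderiv 𝓘(ℝ, E) 𝓘(ℝ, E) (extChartAt 𝓘(ℝ, E) x).symm y (L v)‖ ≤ 2 * ‖v‖) := by
  have hxs : x ∈ (trivializationAt E (TangentSpace 𝓘(ℝ, E)) x).baseSet :=
    FiberBundle.mem_baseSet_trivializationAt' x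
  let L := (trivializationAt E (TangentSpace 𝓘(ℝ, E)) x).continuousLinearEquivAt ℝ x hxs
  have hL : ∀ v, L v =
      (trivializationAt E (TangentSpace 𝓘(ℝ, E)) x).continuousLinearMapAt ℝ x v :=
    congrFun (Bundle.Trivialization.coe_continuousLinearEquivAt_eq _ hxs)
  have hL' : ∀ w, L.symm w = (trivializationAt E (TangentSpace 𝓘(ℝ, E)) x).symmL ℝ x w :=
    congrFun (Bundle.Trivialization.symm_continuousLinearEquivAt_eq _ hxs)
  have hsrc : (chartAt E x).source ∈ 𝓝 x := chart_source_mem_nhds E x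
  refine ⟨L, ?_, ?_⟩
  · filter_upwards [eventually_norm_symmL_trivializationAt_self_comp_lt E
      (fun x : M ↦ TangentSpace 𝓘(ℝ, E) x) x one_lt_two, hsrc] with y hy hys w
    have h := ContinuousLinearMap.le_of_opNorm_le _ hy.le w
    rw [ContinuousLinearMap.comp_apply, ← hL',
      TangentBundle.continuousLinearMapAt_trivializationAt hys] at h
    exact h
  · have hc : Filter.Tendsto (extChartAt 𝓘(ℝ, E) x).symm (𝓝 (extChartAt 𝓘(ℝ, E) x x)) (𝓝 x) := by
      simpa [ContinuousAt] using continuousAt_extChartAt_symm (I := 𝓘(ℝ, E)) x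
    filter_upwards [hc.eventually (eventually_norm_symmL_trivializationAt_comp_self_lt E
      (fun x : M ↦ TangentSpace 𝓘(ℝ, E) x) x one_lt_two), hc.eventually hsrc,
      extChartAt_target_mem_nhds (I := 𝓘(ℝ, E)) x] with y hy hys hyt v
    rw [TangentBundle.symmL_trivializationAt hys] at hy
    have e : extChartAt 𝓘(ℝ, E) x ((extChartAt 𝓘(ℝ, E) x).symm y) = y :=
      (extChartAt 𝓘(ℝ, E) x).right_inv hyt
    -- The base points `y` and `extChartAt x ((extChartAt x).symm y)` are equal only
    -- propositionally. Giving the derivative the fixed type `E →L[ℝ] E` allows the equality to be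
    -- transported by `congrArg`.
    let D : E → E →L[ℝ] E := fun z ↦
      mfderivWithin 𝓘(ℝ, E) 𝓘(ℝ, E) (extChartAt 𝓘(ℝ, E) x).symm (range 𝓘(ℝ, E)) z
    have hD : D (extChartAt 𝓘(ℝ, E) x ((extChartAt 𝓘(ℝ, E) x).symm y)) = D y := congrArg D e
    have hD' : D y = mfderiv 𝓘(ℝ, E) 𝓘(ℝ, E) (extChartAt 𝓘(ℝ, E) x).symm y := by
      simp only [D, modelWithCornersSelf_coe, range_id, mfderivWithin_univ]
      rfl
    have h := ContinuousLinearMap.le_of_opNorm_le _ hy.le v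
    have h' : D (extChartAt 𝓘(ℝ, E) x ((extChartAt 𝓘(ℝ, E) x).symm y)) (L v) =
        mfderiv 𝓘(ℝ, E) 𝓘(ℝ, E) (extChartAt 𝓘(ℝ, E) x).symm y (L v) := by rw [hD, hD']; rfl
    rw [← h', hL]
    exact h

/-- If `(extChartAt x).symm ∘ L` has a derivative of norm at most `2` on a ball, then it is
`2`-Lipschitz there. -/
theorem dist_extChartAt_symm_le [IsRiemannianManifold 𝓘(ℝ, E) M]
    {F : Type*} [NormedAddCommGroup F] [NormedSpace ℝ F] (x : M) (L : F ≃L[ℝ] E) {c : F} {r : ℝ}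
    (ht : ∀ v ∈ ball c r, L v ∈ (extChartAt 𝓘(ℝ, E) x).target)
    (hb : ∀ v ∈ ball c r, ∀ v' : F,
      ‖mfderiv 𝓘(ℝ, E) 𝓘(ℝ, E) (extChartAt 𝓘(ℝ, E) x).symm (L v) (L v')‖ ≤ 2 * ‖v'‖)
    {v w : F} (hv : v ∈ ball c r) (hw : w ∈ ball c r) :
    dist ((extChartAt 𝓘(ℝ, E) x).symm (L v)) ((extChartAt 𝓘(ℝ, E) x).symm (L w))
      ≤ 2 * dist v w := by
  -- The image of the straight segment from `v` to `w` has speed at most `2 * dist v w`, and its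
  -- length bounds the Riemannian distance.
  let η : ℝ → E := fun t ↦ L (v + t • (w - v))
  have hηb : ∀ t ∈ Icc (0 : ℝ) 1, v + t • (w - v) ∈ ball c r := fun t ht ↦
    (convex_ball c r).add_smul_sub_mem hv hw ht
  have hη : ContDiff ℝ ∞ η := by fun_prop
  have hη' : ∀ t, HasFDerivAt η ((1 : ℝ →L[ℝ] ℝ).smulRight (L (w - v))) t := by
    intro t
    have h1 : HasDerivAt (fun t : ℝ ↦ v + t • (w - v)) (w - v) t := by
      simpa using ((hasDerivAt_id t).smul_const (w - v)).const_add v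
    have h2 : HasDerivAt η (L (w - v)) t :=
      (L : F →L[ℝ] E).hasFDerivAt.comp_hasDerivAt t h1
    exact h2.hasFDerivAt
  let γ : ℝ → M := (extChartAt 𝓘(ℝ, E) x).symm ∘ η
  have hγ : ContMDiffOn 𝓘(ℝ, ℝ) 𝓘(ℝ, E) 1 γ (Icc 0 1) := by
    have h1 : ContMDiffOn 𝓘(ℝ, ℝ) 𝓘(ℝ, E) 1 η (Icc 0 1) :=
      ((contMDiff_iff_contDiff.2 hη).of_le (by simp)).contMDiffOn
    exact ((contMDiffOn_extChartAt_symm (n := ∞) x).of_le (by simp)).comp h1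
      fun t h ↦ ht _ (hηb t h)
  have key : edist (γ 0) (γ 1) ≤ ENNReal.ofReal (2 * dist v w) := by
    rw [IsRiemannianManifold.out (I := 𝓘(ℝ, E))]
    refine (Manifold.riemannianEDist_le_pathELength hγ rfl rfl zero_le_one).trans ?_
    rw [Manifold.pathELength_eq_lintegral_mfderiv_Icc]
    have hle : ∀ t ∈ Icc (0 : ℝ) 1,
        ‖mfderiv 𝓘(ℝ, ℝ) 𝓘(ℝ, E) γ t 1‖ₑ ≤ ENNReal.ofReal (2 * dist v w) := by
      intro t h
      have d1 : MDifferentiableAt 𝓘(ℝ, E) 𝓘(ℝ, E) (extChartAt 𝓘(ℝ, E) x).symm (η t) := by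
        have := mdifferentiableWithinAt_extChartAt_symm (I := 𝓘(ℝ, E)) (ht _ (hηb t h))
        rwa [modelWithCornersSelf_coe, range_id, mdifferentiableWithinAt_univ] at this
      have d2 : HasMFDerivAt 𝓘(ℝ, ℝ) 𝓘(ℝ, E) η t ((1 : ℝ →L[ℝ] ℝ).smulRight (L (w - v))) :=
        (hη' t).hasMFDerivAt
      have d3 := (HasMFDerivAt.comp t d1.hasMFDerivAt d2).mfderiv
      have d4 : mfderiv 𝓘(ℝ, ℝ) 𝓘(ℝ, E) γ t (1 : ℝ) =
          mfderiv 𝓘(ℝ, E) 𝓘(ℝ, E) (extChartAt 𝓘(ℝ, E) x).symm (η t) (L (w - v)) := by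
        rw [show mfderiv 𝓘(ℝ, ℝ) 𝓘(ℝ, E) γ t = _ from d3]
        change mfderiv 𝓘(ℝ, E) 𝓘(ℝ, E) (extChartAt 𝓘(ℝ, E) x).symm (η t)
          ((1 : ℝ) • L (w - v)) = _
        rw [one_smul]
      have d5 := hb _ (hηb t h) (w - v)
      rw [dist_comm, dist_eq_norm, ← ofReal_norm]
      refine ENNReal.ofReal_le_ofReal ?_
      exact (le_of_eq (congrArg norm d4)).trans d5
    calc _ ≤ ∫⁻ t in Icc (0 : ℝ) 1, ENNReal.ofReal (2 * dist v w) :=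
          MeasureTheory.setLIntegral_mono' measurableSet_Icc hle
      _ = _ := by simp
  rw [edist_dist, ENNReal.ofReal_le_ofReal_iff (by positivity)] at key
  simpa [γ, η] using key

end

/-! ### Differentials, covector norms and local smoothing -/

section

variable {n : ℕ} {M : Type*} [MetricSpace M] [ChartedSpace (EuclideanSpace ℝ (Fin n)) M]

theorem differential_congr {φ ψ : M → ℝ} {y : M} (h : φ =ᶠ[𝓝 y] ψ) :
    differential (n := n) φ y = differential ψ y :=
  h.mfderiv_eq

theorem differential_eq_zero_of_notMem_tsupport {φ : M → ℝ} {y : M} (h : y ∉ tsupport φ) :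
    differential (n := n) φ y = 0 := by
  rw [differential_congr (notMem_tsupport_iff_eventuallyEq.1 h)]
  exact mfderiv_const

theorem differential_const (c : ℝ) (y : M) : differential (n := n) (fun _ : M ↦ c) y = 0 :=
  mfderiv_const

theorem differential_add {φ ψ : M → ℝ} {y : M} (hφ : MDifferentiableAt (𝓡 n) 𝓘(ℝ, ℝ) φ y)
    (hψ : MDifferentiableAt (𝓡 n) 𝓘(ℝ, ℝ) ψ y) :
    differential (n := n) (φ + ψ) y = differential φ y + differential ψ y :=
  (hφ.hasMFDerivAt.add hψ.hasMFDerivAt).mfderiv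

theorem differential_mul {φ ψ : M → ℝ} {y : M} (hφ : MDifferentiableAt (𝓡 n) 𝓘(ℝ, ℝ) φ y)
    (hψ : MDifferentiableAt (𝓡 n) 𝓘(ℝ, ℝ) ψ y) :
    differential (n := n) (φ * ψ) y = φ y • differential ψ y + ψ y • differential φ y :=
  (HasMFDerivAt.mul hφ.hasMFDerivAt hψ.hasMFDerivAt).mfderiv

theorem differential_comp {g : ℝ → ℝ} {φ : M → ℝ} {y : M} (hg : DifferentiableAt ℝ g (φ y))
    (hφ : MDifferentiableAt (𝓡 n) 𝓘(ℝ, ℝ) φ y) :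
    differential (n := n) (g ∘ φ) y = deriv g (φ y) • differential φ y := by
  have h1 : HasMFDerivAt 𝓘(ℝ, ℝ) 𝓘(ℝ, ℝ) g (φ y) (fderiv ℝ g (φ y)) := hg.hasFDerivAt.hasMFDerivAt
  have h2 := (HasMFDerivAt.comp y h1 hφ.hasMFDerivAt).mfderiv
  ext w
  have h3 : differential (n := n) (g ∘ φ) y w = fderiv ℝ g (φ y) (differential φ y w) :=
    congrArg (fun T : TangentSpace (𝓡 n) y →L[ℝ] ℝ ↦ T w) h2
  rw [h3, fderiv_eq_deriv_mul, smul_apply, smul_eq_mul]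

theorem differential_sum {ι : Type*} (s : Finset ι) {φ : ι → M → ℝ} {y : M}
    (hφ : ∀ i ∈ s, MDifferentiableAt (𝓡 n) 𝓘(ℝ, ℝ) (φ i) y) :
    differential (n := n) (∑ i ∈ s, φ i) y = ∑ i ∈ s, differential (φ i) y ∧
      MDifferentiableAt (𝓡 n) 𝓘(ℝ, ℝ) (∑ i ∈ s, φ i) y := by
  classical
  induction s using Finset.induction_on with
  | empty =>
    simp only [Finset.sum_empty]
    exact ⟨differential_const 0 y, mdifferentiableAt_const⟩
  | insert i s hi ih =>
    obtain ⟨h1, h2⟩ := ih fun j hj ↦ hφ j (Finset.mem_insert_of_mem hj)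
    have h3 := hφ i (Finset.mem_insert_self i s)
    rw [Finset.sum_insert hi, Finset.sum_insert hi, differential_add h3 h2, h1]
    exact ⟨rfl, (h3.hasMFDerivAt.add h2.hasMFDerivAt).mdifferentiableAt⟩

variable [Bundle.RiemannianBundle (fun x : M ↦ TangentSpace (𝓡 n) x)]

theorem covectorNorm_zero {x : M} : covectorNorm (0 : TangentSpace (𝓡 n) x →L[ℝ] ℝ) = 0 :=
  ContinuousLinearMap.opNorm_zero

theorem covectorNorm_nonneg {x : M} (ξ : TangentSpace (𝓡 n) x →L[ℝ] ℝ) : 0 ≤ covectorNorm ξ :=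
  norm_nonneg ξ

theorem covectorNorm_add_le {x : M} (ξ η : TangentSpace (𝓡 n) x →L[ℝ] ℝ) :
    covectorNorm (ξ + η) ≤ covectorNorm ξ + covectorNorm η :=
  norm_add_le ξ η

theorem abs_covectorNorm_sub_le {x : M} (ξ η : TangentSpace (𝓡 n) x →L[ℝ] ℝ) :
    |covectorNorm ξ - covectorNorm η| ≤ covectorNorm (ξ - η) :=
  abs_norm_sub_norm_le ξ η

theorem covectorNorm_smul_le {x : M} (c : ℝ) (ξ : TangentSpace (𝓡 n) x →L[ℝ] ℝ) :
    covectorNorm (c • ξ) ≤ |c| * covectorNorm ξ := by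
  refine ContinuousLinearMap.opNorm_le_bound _
    (mul_nonneg (abs_nonneg c) (covectorNorm_nonneg ξ)) fun w ↦ ?_
  rw [smul_apply, norm_smul, Real.norm_eq_abs, mul_assoc]
  exact mul_le_mul_of_nonneg_left (ContinuousLinearMap.le_opNorm ξ w) (abs_nonneg c)

theorem covectorNorm_sum_le {x : M} {ι : Type*} (s : Finset ι)
    (ξ : ι → TangentSpace (𝓡 n) x →L[ℝ] ℝ) :
    covectorNorm (∑ i ∈ s, ξ i) ≤ ∑ i ∈ s, covectorNorm (ξ i) :=
  norm_sum_le s ξ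

variable [IsManifold (𝓡 n) ∞ M]

/-- If the metric near `x` is comparable to the norm of `F` in the chart at `x` followed by `L⁻¹`,
then a `1`-Lipschitz function has smooth approximations near `x` with bounded differential. -/
theorem exists_local_smooth_approx_of_equiv [IsRiemannianManifold (𝓡 n) M]
    {F : Type*} [NormedAddCommGroup F] [NormedSpace ℝ F] [FiniteDimensional ℝ F]
    (x : M) (L : F ≃L[ℝ] EuclideanSpace ℝ (Fin n))
    (h₁ : ∀ᶠ y in 𝓝 x, ∀ w : TangentSpace (𝓡 n) y,
        ‖L.symm (mfderiv (𝓡 n) (𝓡 n) (extChartAt (𝓡 n) x) y w)‖ ≤ 2 * ‖w‖)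
    (h₂ : ∀ᶠ y in 𝓝 (extChartAt (𝓡 n) x x), ∀ v : F,
        ‖mfderiv (𝓡 n) (𝓡 n) (extChartAt (𝓡 n) x).symm y (L v)‖ ≤ 2 * ‖v‖) :
    ∃ U : Set M, IsOpen U ∧ x ∈ U ∧ ∀ f : M → ℝ, LipschitzWith 1 f → ∀ δ > 0,
      ∃ h : M → ℝ, ContMDiffOn (𝓡 n) 𝓘(ℝ, ℝ) ∞ h U ∧
        ∀ y ∈ U, |h y - f y| ≤ δ ∧ covectorNorm (differential (n := n) h y) ≤ 4 := by
  let c : F := L.symm (extChartAt (𝓡 n) x x)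
  have hc : Filter.Tendsto L (𝓝 c) (𝓝 (extChartAt (𝓡 n) x x)) := by
    have := L.continuous.tendsto c
    rwa [show L c = extChartAt (𝓡 n) x x from L.apply_symm_apply _] at this
  obtain ⟨r, hr, hball⟩ := Metric.mem_nhds_iff.1
    (hc.eventually (h₂.and (extChartAt_target_mem_nhds (I := (𝓡 n)) x)))
  have hΨ : ∀ᶠ y in 𝓝 x, L.symm (extChartAt (𝓡 n) x y) ∈ ball c r :=
    (L.symm.continuous.continuousAt.comp (continuousAt_extChartAt (I := (𝓡 n)) x)).eventually_mem
      (ball_mem_nhds _ hr)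
  obtain ⟨U, hU, hUo, hxU⟩ := _root_.mem_nhds_iff.1
    ((h₁.and hΨ).and (chart_source_mem_nhds (EuclideanSpace ℝ (Fin n)) x))
  refine ⟨U, hUo, hxU, fun f hf δ hδ ↦ ?_⟩
  have hlip : LipschitzOnWith 2 (fun v ↦ f ((extChartAt (𝓡 n) x).symm (L v))) (ball c r) := by
    refine LipschitzOnWith.of_dist_le_mul fun v hv w hw ↦ ?_
    have h := dist_extChartAt_symm_le x L (fun v hv ↦ (hball hv).2) (fun v hv ↦ (hball hv).1) hv hw
    have h' := hf.dist_le_mul ((extChartAt (𝓡 n) x).symm (L v))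
      ((extChartAt (𝓡 n) x).symm (L w))
    simp only [NNReal.coe_one, one_mul, NNReal.coe_ofNat] at h' ⊢
    exact h'.trans h
  -- Mollification needs a function on all of `F`, so the chart expression is extended with the same
  -- constant `2`. The final `4` is this `2` times the bound `2` on the differential of the chart.
  obtain ⟨g, hg, hgeq⟩ := hlip.extend_real
  obtain ⟨G, hG, hGg, hG'⟩ := exists_contDiff_dist_le_norm_fderiv_le hg hδ
  refine ⟨fun y ↦ G (L.symm (extChartAt (𝓡 n) x y)), ?_, fun y hy ↦ ⟨?_, ?_⟩⟩
  · have h1 : ContMDiff (𝓡 n) 𝓘(ℝ, ℝ) ∞ (fun e : EuclideanSpace ℝ (Fin n) ↦ G (L.symm e)) :=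
      contMDiff_iff_contDiff.2 (hG.comp L.symm.contDiff)
    exact h1.comp_contMDiffOn ((contMDiffOn_extChartAt (n := ∞)).mono fun y hy ↦ (hU hy).2)
  · have hy' := hU hy
    have h1 := hGg (L.symm (extChartAt (𝓡 n) x y))
    have hgy : f y = g (L.symm (extChartAt (𝓡 n) x y)) := by
      rw [← hgeq hy'.1.2]
      simp only [L.apply_symm_apply]
      rw [(extChartAt (𝓡 n) x).left_inv (by rw [extChartAt_source]; exact hy'.2)]
    rwa [hgy]
  · have hy' := hU hy
    refine ContinuousLinearMap.opNorm_le_bound _ (by norm_num) fun w ↦ ?_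
    have d1 : HasFDerivAt (fun e : EuclideanSpace ℝ (Fin n) ↦ G (L.symm e))
        ((fderiv ℝ G (L.symm (extChartAt (𝓡 n) x y))).comp
          (L.symm : EuclideanSpace ℝ (Fin n) →L[ℝ] F))
        (extChartAt (𝓡 n) x y) :=
      ((hG.differentiable (by simp)) _).hasFDerivAt.comp _ L.symm.hasFDerivAt
    have d2 := (mdifferentiableAt_extChartAt (I := (𝓡 n)) hy'.2).hasMFDerivAt
    have d3 := (HasMFDerivAt.comp y d1.hasMFDerivAt d2).mfderiv
    have d4 : differential (n := n) (fun y ↦ G (L.symm (extChartAt (𝓡 n) x y))) y w =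
        fderiv ℝ G (L.symm (extChartAt (𝓡 n) x y))
          (L.symm (mfderiv (𝓡 n) (𝓡 n) (extChartAt (𝓡 n) x) y w)) :=
      congrArg (fun T : TangentSpace (𝓡 n) y →L[ℝ] ℝ ↦ T w) d3
    have d5 := ContinuousLinearMap.le_of_opNorm_le _ (hG' (L.symm (extChartAt (𝓡 n) x y)))
      (L.symm (mfderiv (𝓡 n) (𝓡 n) (extChartAt (𝓡 n) x) y w))
    have d6 := hy'.1.1 w
    have d7 : ‖differential (n := n) (fun y ↦ G (L.symm (extChartAt (𝓡 n) x y))) y w‖ ≤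
      2 * ‖L.symm (mfderiv (𝓡 n) (𝓡 n) (extChartAt (𝓡 n) x) y w)‖ :=
      (le_of_eq (congrArg norm d4)).trans d5
    linarith

/-- Near every point, a `1`-Lipschitz function can be approximated by smooth functions whose
differential has norm at most `4`. -/
theorem exists_local_smooth_approx [IsRiemannianManifold (𝓡 n) M]
    [IsContinuousRiemannianBundle (EuclideanSpace ℝ (Fin n)) (fun x : M ↦ TangentSpace (𝓡 n) x)]
    (x : M) :
    ∃ U : Set M, IsOpen U ∧ x ∈ U ∧ ∀ f : M → ℝ, LipschitzWith 1 f → ∀ δ > 0,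
      ∃ h : M → ℝ, ContMDiffOn (𝓡 n) 𝓘(ℝ, ℝ) ∞ h U ∧
        ∀ y ∈ U, |h y - f y| ≤ δ ∧ covectorNorm (differential (n := n) h y) ≤ 4 := by
  obtain ⟨L, h₁, h₂⟩ := exists_tangentSpace_equiv_norm_le (E := EuclideanSpace ℝ (Fin n)) x
  -- Finite dimension depends only on the module structure, so it passes from the Euclidean norm to
  -- the Riemannian one.
  have : FiniteDimensional ℝ (TangentSpace (𝓡 n) x) :=
    inferInstanceAs (FiniteDimensional ℝ (EuclideanSpace ℝ (Fin n)))
  exact exists_local_smooth_approx_of_equiv x L h₁ h₂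

/-- The differential of a smooth function with compact support is bounded. -/
theorem exists_covectorNorm_differential_le
    [IsContinuousRiemannianBundle (EuclideanSpace ℝ (Fin n)) (fun x : M ↦ TangentSpace (𝓡 n) x)]
    {ρ : M → ℝ} (hρ : ContMDiff (𝓡 n) 𝓘(ℝ, ℝ) ∞ ρ) (hc : HasCompactSupport ρ) :
    ∃ B : ℝ, 0 ≤ B ∧ ∀ y, covectorNorm (differential (n := n) ρ y) ≤ B := by
  have hloc : ∀ x : M, ∃ B : ℝ, ∀ᶠ y in 𝓝 x, covectorNorm (differential (n := n) ρ y) ≤ B := by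
    intro x
    obtain ⟨L, h₁, -⟩ := exists_tangentSpace_equiv_norm_le (E := EuclideanSpace ℝ (Fin n)) x
    let R : EuclideanSpace ℝ (Fin n) → ℝ := ρ ∘ (extChartAt (𝓡 n) x).symm
    have hto : IsOpen (extChartAt (𝓡 n) x).target := isOpen_extChartAt_target x
    have hR : ContDiffOn ℝ ∞ R (extChartAt (𝓡 n) x).target :=
      contMDiffOn_iff_contDiffOn.1 (hρ.comp_contMDiffOn (contMDiffOn_extChartAt_symm (n := ∞) x))
    have hR' : ContinuousAt (fun y : M ↦ ‖fderiv ℝ R (extChartAt (𝓡 n) x y)‖) x := by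
      have h1 : ContinuousAt (fderiv ℝ R) (extChartAt (𝓡 n) x x) :=
        (hR.continuousOn_fderiv_of_isOpen hto (by simp)).continuousAt
          (hto.mem_nhds (mem_extChartAt_target x))
      exact (ContinuousAt.comp (f := extChartAt (𝓡 n) x) h1
        (continuousAt_extChartAt (I := (𝓡 n)) x)).norm
    refine ⟨(‖fderiv ℝ R (extChartAt (𝓡 n) x x)‖ + 1) *
      (‖(L : TangentSpace (𝓡 n) x →L[ℝ] EuclideanSpace ℝ (Fin n))‖ * 2), ?_⟩
    filter_upwards [h₁, chart_source_mem_nhds (EuclideanSpace ℝ (Fin n)) x,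
      hR'.eventually_lt (continuousAt_const (y := ‖fderiv ℝ R (extChartAt (𝓡 n) x x)‖ + 1))
        (by simp)] with y hy hys hyR
    refine ContinuousLinearMap.opNorm_le_bound _ (by positivity) fun w ↦ ?_
    have hys' : y ∈ (extChartAt (𝓡 n) x).source := by rwa [extChartAt_source]
    have d1 : HasFDerivAt R (fderiv ℝ R (extChartAt (𝓡 n) x y)) (extChartAt (𝓡 n) x y) :=
      ((hR.contDiffAt (hto.mem_nhds ((extChartAt (𝓡 n) x).map_source hys'))).differentiableAt
        (by simp)).hasFDerivAt
    have d2 := (mdifferentiableAt_extChartAt (I := (𝓡 n)) hys).hasMFDerivAt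
    have d3 := (HasMFDerivAt.comp y d1.hasMFDerivAt d2).mfderiv
    have heq : ρ =ᶠ[𝓝 y] R ∘ extChartAt (𝓡 n) x := by
      filter_upwards [(isOpen_extChartAt_source (I := (𝓡 n)) x).mem_nhds hys'] with z hz
      simp only [R, Function.comp, (extChartAt (𝓡 n) x).left_inv hz]
    have d4 : differential (n := n) ρ y w = fderiv ℝ R (extChartAt (𝓡 n) x y)
        (mfderiv (𝓡 n) (𝓡 n) (extChartAt (𝓡 n) x) y w) := by
      have h1 : differential (n := n) ρ y w =
          differential (n := n) (R ∘ extChartAt (𝓡 n) x) y w := by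
        rw [differential_congr heq]
      exact h1.trans (congrArg (fun T : TangentSpace (𝓡 n) y →L[ℝ] ℝ ↦ T w) d3)
    let e : EuclideanSpace ℝ (Fin n) := mfderiv (𝓡 n) (𝓡 n) (extChartAt (𝓡 n) x) y w
    have d5 : ‖e‖ ≤ ‖(L : TangentSpace (𝓡 n) x →L[ℝ] EuclideanSpace ℝ (Fin n))‖ * (2 * ‖w‖) := by
      have h1 := (L : TangentSpace (𝓡 n) x →L[ℝ] EuclideanSpace ℝ (Fin n)).le_opNorm (L.symm e)
      rw [ContinuousLinearEquiv.coe_coe, L.apply_symm_apply] at h1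
      exact h1.trans (mul_le_mul_of_nonneg_left (hy w) (norm_nonneg _))
    calc ‖differential (n := n) ρ y w‖ = ‖fderiv ℝ R (extChartAt (𝓡 n) x y) e‖ :=
          congrArg norm d4
      _ ≤ ‖fderiv ℝ R (extChartAt (𝓡 n) x y)‖ * ‖e‖ := ContinuousLinearMap.le_opNorm _ _
      _ ≤ (‖fderiv ℝ R (extChartAt (𝓡 n) x x)‖ + 1) *
          (‖(L : TangentSpace (𝓡 n) x →L[ℝ] EuclideanSpace ℝ (Fin n))‖ * (2 * ‖w‖)) := by gcongr
      _ = _ := by ring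
  obtain ⟨B, hB⟩ : ∃ B : ℝ, ∀ y ∈ tsupport ρ, covectorNorm (differential (n := n) ρ y) ≤ B := by
    refine hc.isCompact.induction_on (p := fun s ↦ ∃ B : ℝ, ∀ y ∈ s,
      covectorNorm (differential (n := n) ρ y) ≤ B) ⟨0, by simp⟩ ?_ ?_ ?_
    · rintro s t hst ⟨B, hB⟩
      exact ⟨B, fun y hy ↦ hB y (hst hy)⟩
    · rintro s t ⟨B, hB⟩ ⟨B', hB'⟩
      refine ⟨max B B', fun y hy ↦ ?_⟩
      rcases hy with hy | hy
      · exact (hB y hy).trans (le_max_left _ _)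
      · exact (hB' y hy).trans (le_max_right _ _)
    · intro x _
      obtain ⟨B, hB⟩ := hloc x
      exact ⟨_, mem_nhdsWithin_of_mem_nhds hB, B, fun y hy ↦ hy⟩
  refine ⟨max B 0, le_max_right _ _, fun y ↦ ?_⟩
  by_cases hy : y ∈ tsupport ρ
  · exact (hB y hy).trans (le_max_left _ _)
  · rw [differential_eq_zero_of_notMem_tsupport hy, covectorNorm_zero]
    exact le_max_right _ _

end

/-! ### Gluing and cutoff functions -/

section

variable {n : ℕ} {M : Type*} [MetricSpace M] [ChartedSpace (EuclideanSpace ℝ (Fin n)) M]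
  [Bundle.RiemannianBundle (fun x : M ↦ TangentSpace (𝓡 n) x)]

/-- Gluing local approximations `h i` of a function `f` by means of a partition of unity gives an
approximation of `f` whose differential is controlled. -/
theorem covectorNorm_differential_sum_le {ι : Type*} [Fintype ι]
    (ρ : SmoothPartitionOfUnity ι (𝓡 n) M univ) (h : ι → M → ℝ) (f : M → ℝ) (y : M) (ε : ι → ℝ)
    {C : ℝ} (hC : 0 ≤ C) (hε : ∀ i, 0 ≤ ε i)
    (hh : ∀ i, y ∈ tsupport (ρ i) → MDifferentiableAt (𝓡 n) 𝓘(ℝ, ℝ) (h i) y)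
    (hd : ∀ i, y ∈ tsupport (ρ i) → covectorNorm (differential (n := n) (h i) y) ≤ C)
    (hf : ∀ i, y ∈ tsupport (ρ i) →
      |h i y - f y| * covectorNorm (differential (n := n) (ρ i) y) ≤ ε i) :
    covectorNorm (differential (n := n) (∑ i, (ρ i : M → ℝ) * h i) y) ≤ C + ∑ i, ε i := by
  have hρ : ∀ i, MDifferentiableAt (𝓡 n) 𝓘(ℝ, ℝ) (ρ i : M → ℝ) y := fun i ↦
    (ρ i).contMDiff.mdifferentiableAt (by simp)
  have hone : ∀ z, ∑ i, ρ i z = 1 := fun z ↦ by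
    rw [← finsum_eq_sum_of_fintype]; exact ρ.sum_eq_one (mem_univ z)
  have hprod : ∀ i ∈ Finset.univ, MDifferentiableAt (𝓡 n) 𝓘(ℝ, ℝ) ((ρ i : M → ℝ) * h i) y := by
    intro i _
    by_cases hy : y ∈ tsupport (ρ i)
    · exact (HasMFDerivAt.mul (hρ i).hasMFDerivAt (hh i hy).hasMFDerivAt).mdifferentiableAt
    · refine (mdifferentiableAt_const (c := (0 : ℝ))).congr_of_eventuallyEq ?_
      filter_upwards [notMem_tsupport_iff_eventuallyEq.1 hy] with z hz
      simp [hz]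
  have hzero : ∑ i, differential (n := n) (ρ i) y = 0 := by
    rw [← (differential_sum Finset.univ fun i _ ↦ hρ i).1,
      show (∑ i, (ρ i : M → ℝ)) = fun _ ↦ 1 by ext z; simpa using hone z]
    exact differential_const 1 y
  -- Since `∑ dρ i = 0`, the number `f y` may be subtracted: each `dρ i` is then multiplied by the
  -- small error `h i y - f y`, and no differentiability of `f` is needed.
  have hsum : differential (n := n) (∑ i, (ρ i : M → ℝ) * h i) y =
      ∑ i, (differential (n := n) ((ρ i : M → ℝ) * h i) y - f y • differential (ρ i) y) := by
    rw [Finset.sum_sub_distrib, ← Finset.smul_sum, hzero, smul_zero, sub_zero]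
    exact (differential_sum Finset.univ hprod).1
  rw [hsum]
  refine (covectorNorm_sum_le _ _).trans ?_
  have hterm : ∀ i, covectorNorm (differential (n := n) ((ρ i : M → ℝ) * h i) y -
      f y • differential (n := n) (ρ i) y) ≤ ρ i y * C + ε i := by
    intro i
    by_cases hy : y ∈ tsupport (ρ i)
    · have e : differential (n := n) ((ρ i : M → ℝ) * h i) y - f y • differential (n := n) (ρ i) y =
          ρ i y • differential (h i) y + (h i y - f y) • differential (ρ i) y := by
        rw [differential_mul (hρ i) (hh i hy)]
        ext w
        simp only [add_apply, sub_apply, smul_apply, smul_eq_mul]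
        ring
      rw [e]
      refine (covectorNorm_add_le _ _).trans (add_le_add ?_ ?_)
      · refine (covectorNorm_smul_le _ _).trans ?_
        rw [abs_of_nonneg (ρ.nonneg i y)]
        exact mul_le_mul_of_nonneg_left (hd i hy) (ρ.nonneg i y)
      · exact (covectorNorm_smul_le _ _).trans (hf i hy)
    · have hy' : y ∉ tsupport ((ρ i : M → ℝ) * h i) := fun h' ↦
        hy (tsupport_mul_subset_left h')
      rw [differential_eq_zero_of_notMem_tsupport hy, differential_eq_zero_of_notMem_tsupport hy',
        smul_zero, sub_zero, covectorNorm_zero]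
      exact add_nonneg (mul_nonneg (ρ.nonneg i y) hC) (hε i)
  calc _ ≤ ∑ i, (ρ i y * C + ε i) := Finset.sum_le_sum fun i _ ↦ hterm i
    _ = C + ∑ i, ε i := by rw [Finset.sum_add_distrib, ← Finset.sum_mul, hone, one_mul]

/-- On a Riemannian manifold whose closed balls are compact, a compactly supported `1`-Lipschitz
function is close to a smooth compactly supported function with bounded differential. -/
theorem exists_smooth_approx [ProperSpace M] [IsManifold (𝓡 n) ∞ M]
    [IsRiemannianManifold (𝓡 n) M]
    [IsContinuousRiemannianBundle (EuclideanSpace ℝ (Fin n)) (fun x : M ↦ TangentSpace (𝓡 n) x)]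
    {f : M → ℝ} (hf : LipschitzWith 1 f) (hfc : HasCompactSupport f) :
    ∃ h : M → ℝ, ContMDiff (𝓡 n) 𝓘(ℝ, ℝ) ∞ h ∧ HasCompactSupport h ∧ (∀ y, |h y - f y| ≤ 1) ∧
      ∀ y, covectorNorm (differential (n := n) h y) ≤ 5 := by
  -- The sets `U x` do not depend on the precision `δ`, so the partition of unity can be fixed
  -- before `δ` is chosen in terms of its differentials.
  choose U hUo hxU hU using fun x : M ↦ exists_local_smooth_approx (n := n) x
  obtain ⟨t, ht⟩ := hfc.isCompact.elim_finite_subcover (fun x ↦ U x ∩ ball x 1)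
    (fun x ↦ (hUo x).inter isOpen_ball)
    (fun x _ ↦ mem_iUnion.2 ⟨x, hxU x, mem_ball_self one_pos⟩)
  -- The index `none` is the complement of the support of `f`, where `0` is an exact approximation.
  -- The unit balls make the other members of the partition compactly supported.
  let V : Option t → Set M := fun i ↦ i.elim (tsupport f)ᶜ fun x ↦ U x ∩ ball (x : M) 1
  have hVo : ∀ i, IsOpen (V i) := by
    rintro (_ | x)
    · exact (isClosed_tsupport f).isOpen_compl
    · exact (hUo x).inter isOpen_ball
  obtain ⟨ρ, hρ⟩ := SmoothPartitionOfUnity.exists_isSubordinate (𝓡 n) isClosed_univ V hVo (by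
    intro y _
    by_cases hy : y ∈ tsupport f
    · obtain ⟨x, hx, hyx⟩ := mem_iUnion₂.1 (ht hy)
      exact mem_iUnion.2 ⟨some ⟨x, hx⟩, hyx⟩
    · exact mem_iUnion.2 ⟨none, hy⟩)
  have hρc : ∀ x : t, HasCompactSupport (ρ (some x)) := fun x ↦
    (isCompact_closedBall (x : M) 1).of_isClosed_subset (isClosed_tsupport _)
      fun y hy ↦ ball_subset_closedBall (hρ (some x) hy).2
  choose B hB0 hB using fun x : t ↦
    exists_covectorNorm_differential_le (n := n) (ρ (some x)).contMDiff (hρc x)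
  have hBs : 0 ≤ ∑ x, B x := Finset.sum_nonneg fun x _ ↦ hB0 x
  -- With this choice `δ * ∑ B x ≤ 1`, so gluing raises the bound from `4` to at most `5`.
  let δ : ℝ := 1 / (1 + ∑ x, B x)
  have hδ : 0 < δ := by positivity
  have hδ1 : δ ≤ 1 := by
    rw [div_le_one (by positivity)]; linarith
  choose g hg hg' using fun x : t ↦ hU x f hf δ hδ
  let h : Option t → M → ℝ := fun i ↦ i.elim (fun _ ↦ 0) g
  have hfnone : ∀ y ∈ tsupport (ρ none), f y = 0 := fun y hy ↦
    image_eq_zero_of_notMem_tsupport (hρ none hy)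
  have hsm : ∀ i, ContMDiffOn (𝓡 n) 𝓘(ℝ, ℝ) ∞ (h i) (V i) := by
    rintro (_ | x)
    · exact contMDiffOn_const
    · exact (hg x).mono inter_subset_left
  have hone : ∀ z, ∑ i, ρ i z = 1 := fun z ↦ by
    rw [← finsum_eq_sum_of_fintype]; exact ρ.sum_eq_one (mem_univ z)
  have hclose : ∀ i, ∀ y ∈ tsupport (ρ i), |h i y - f y| ≤ 1 := by
    rintro (_ | x) y hy
    · simp [h, hfnone y hy]
    · exact ((hg' x y (hρ (some x) hy).1).1).trans hδ1
  refine ⟨∑ i, (ρ i : M → ℝ) * h i, ?_, ?_, fun y ↦ ?_, fun y ↦ ?_⟩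
  · have h1 := hρ.contMDiff_finsum_smul hVo hsm
    convert h1 using 1
    ext y
    rw [finsum_eq_sum_of_fintype]
    simp
  · refine HasCompactSupport.intro (isCompact_iUnion fun x : t ↦ hρc x) fun y hy ↦ ?_
    rw [mem_iUnion, not_exists] at hy
    rw [Finset.sum_apply, Fintype.sum_option]
    have h1 : ∀ x : t, ((ρ (some x) : M → ℝ) * h (some x)) y = 0 := fun x ↦ by
      rw [Pi.mul_apply, image_eq_zero_of_notMem_tsupport (hy x), zero_mul]
    rw [Finset.sum_eq_zero fun x _ ↦ h1 x]
    simp [h]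
  · have e : (∑ i, (ρ i : M → ℝ) * h i) y - f y = ∑ i, ρ i y * (h i y - f y) := by
      simp only [Finset.sum_apply, Pi.mul_apply, mul_sub, Finset.sum_sub_distrib,
        ← Finset.sum_mul, hone, one_mul]
    rw [e]
    calc |∑ i, ρ i y * (h i y - f y)| ≤ ∑ i, |ρ i y * (h i y - f y)| :=
          Finset.abs_sum_le_sum_abs _ _
      _ ≤ ∑ i, ρ i y := by
        refine Finset.sum_le_sum fun i _ ↦ ?_
        rw [abs_mul, abs_of_nonneg (ρ.nonneg i y)]
        by_cases hy : y ∈ tsupport (ρ i)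
        · exact mul_le_of_le_one_right (ρ.nonneg i y) (hclose i y hy)
        · rw [image_eq_zero_of_notMem_tsupport hy, zero_mul]
      _ = 1 := hone y
  · let ε : Option t → ℝ := fun i ↦ i.elim 0 fun x ↦ δ * B x
    refine (covectorNorm_differential_sum_le ρ h f y ε (C := 4) (by norm_num) ?_ ?_ ?_ ?_).trans ?_
    · rintro (_ | x)
      · exact le_rfl
      · exact mul_nonneg hδ.le (hB0 x)
    · intro i hy
      exact ((hsm i).contMDiffAt ((hVo i).mem_nhds (hρ i hy))).mdifferentiableAt (by simp)
    · rintro (_ | x) hy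
      · change covectorNorm (differential (n := n) (fun _ : M ↦ (0 : ℝ)) y) ≤ 4
        rw [differential_const, covectorNorm_zero]
        norm_num
      · exact (hg' x y (hρ (some x) hy).1).2
    · rintro (_ | x) hy
      · simp [h, ε, hfnone y hy]
      · exact mul_le_mul (hg' x y (hρ (some x) hy).1).1 (hB x y) (covectorNorm_nonneg _) hδ.le
    · rw [Fintype.sum_option]
      have : δ * ∑ x, B x ≤ 1 := by
        simp only [δ]
        rw [div_mul_eq_mul_div, div_le_one (by positivity)]
        linarith
      simp only [ε, Option.elim, ← Finset.mul_sum]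
      linarith

/-- Smooth cutoff functions with compact support and small differential on a complete Riemannian
manifold. -/
theorem exists_cutoff [CompleteSpace M] [IsManifold (𝓡 n) ∞ M] [IsRiemannianManifold (𝓡 n) M]
    [IsContinuousRiemannianBundle (EuclideanSpace ℝ (Fin n)) (fun x : M ↦ TangentSpace (𝓡 n) x)]
    (x₀ : M) (k : ℕ) :
    ∃ χ : M → ℝ, ContMDiff (𝓡 n) 𝓘(ℝ, ℝ) ∞ χ ∧ HasCompactSupport χ ∧ (∀ y, |χ y| ≤ 1) ∧
      (∀ y, 1 - (dist y x₀ + 2) / (k + 1) ≤ χ y) ∧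
      ∀ y, covectorNorm (differential (n := n) χ y) ≤ 5 / (k + 1) := by
  have : LocallyCompactSpace M := ChartedSpace.locallyCompactSpace (EuclideanSpace ℝ (Fin n)) M
  have : ProperSpace M := properSpace_of_completeSpace (𝓡 n) M
  -- This cone of height `k` is smoothed up to an error `1` and divided by `k + 1`, which keeps the
  -- result within `[-1, 1]` and makes its differential small.
  let f : M → ℝ := fun y ↦ max (k - dist y x₀) 0
  have hf : LipschitzWith 1 f := by
    refine LipschitzWith.of_dist_le_mul fun y z ↦ ?_
    rw [NNReal.coe_one, one_mul, Real.dist_eq]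
    refine (abs_max_sub_max_le_abs _ _ _).trans ?_
    rw [sub_sub_sub_cancel_left, dist_comm y z]
    exact abs_dist_sub_le z y x₀
  have hfc : HasCompactSupport f := by
    refine HasCompactSupport.intro (isCompact_closedBall x₀ k) fun y hy ↦ ?_
    rw [mem_closedBall, not_le] at hy
    exact max_eq_right (by linarith)
  obtain ⟨h, hs, hc, hhf, hd⟩ := exists_smooth_approx (n := n) hf hfc
  have hk : (0 : ℝ) < k + 1 := by positivity
  have hsm : ContMDiff (𝓡 n) 𝓘(ℝ, ℝ) ∞ ((k + 1 : ℝ)⁻¹ • h) := by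
    have h1 : ContDiff ℝ ∞ fun s : ℝ ↦ (k + 1 : ℝ)⁻¹ • s := by fun_prop
    exact (contMDiff_iff_contDiff.2 h1).comp hs
  refine ⟨(k + 1 : ℝ)⁻¹ • h, hsm, hc.smul_left, fun y ↦ ?_, fun y ↦ ?_, fun y ↦ ?_⟩
  · rw [Pi.smul_apply, smul_eq_mul, abs_mul, abs_of_pos (inv_pos.2 hk), inv_mul_le_one₀ hk]
    have h1 : |f y| ≤ k := by
      rw [abs_of_nonneg (le_max_right _ _)]
      exact max_le (by linarith [dist_nonneg (x := y) (y := x₀)]) (by positivity)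
    have h2 : |h y| ≤ |h y - f y| + |f y| := by simpa using abs_add_le (h y - f y) (f y)
    linarith [hhf y]
  · have h1 := (abs_le.1 (hhf y)).1
    have h2 : k - dist y x₀ ≤ f y := le_max_left _ _
    rw [Pi.smul_apply, smul_eq_mul, inv_mul_eq_div, one_sub_div hk.ne']
    gcongr
    linarith
  · have e : differential (n := n) ((k + 1 : ℝ)⁻¹ • h) y = (k + 1 : ℝ)⁻¹ • differential h y :=
      ((hs.mdifferentiableAt (by simp)).hasMFDerivAt.const_smul _).mfderiv
    rw [e]
    refine (covectorNorm_smul_le _ _).trans ?_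
    rw [abs_of_pos (inv_pos.2 hk), inv_mul_eq_div]
    gcongr
    exact hd y

end

/-! ### Truncation, interpolation, Fatou and Markov -/

section

open MeasureTheory Filter

/-- A smooth version of the truncation `s ↦ sign s * (|s| - t)₊`. -/
theorem exists_smooth_truncation {t : ℝ} (ht : 0 < t) :
    ∃ ψ : ℝ → ℝ, ContDiff ℝ ∞ ψ ∧ (∀ s, |deriv ψ s| ≤ 1) ∧ (∀ s, |s| ≤ 2 * t → ψ s = 0) ∧
      (∀ s, |ψ s| ≤ |s|) ∧ (∀ s, |s - ψ s| ≤ |s|) ∧ ∀ s, |s - ψ s| ≤ 3 * t := by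
  -- The argument is nonpositive for `|x| ≤ 2t` and at least `9 - 4 ≥ 1` for `|x| ≥ 3t`. The
  -- truncation `ψ` is the primitive of `η`.
  let η : ℝ → ℝ := fun x ↦ Real.smoothTransition ((x / t) ^ 2 - 4)
  have hη : ContDiff ℝ ∞ η := Real.smoothTransition.contDiff.comp (by fun_prop)
  have hη0 : ∀ x, 0 ≤ η x := fun x ↦ Real.smoothTransition.nonneg _
  have hη1 : ∀ x, η x ≤ 1 := fun x ↦ Real.smoothTransition.le_one _
  have hηz : ∀ x, |x| ≤ 2 * t → η x = 0 := by
    intro x hx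
    refine Real.smoothTransition.zero_of_nonpos ?_
    have h1 : |x / t| ≤ 2 := by rwa [abs_div, abs_of_pos ht, div_le_iff₀ ht]
    rw [← sq_abs]
    nlinarith [abs_nonneg (x / t)]
  have hηo : ∀ x, 3 * t ≤ |x| → η x = 1 := by
    intro x hx
    refine Real.smoothTransition.one_of_one_le ?_
    have h1 : 3 ≤ |x / t| := by rwa [abs_div, abs_of_pos ht, le_div_iff₀ ht]
    rw [← sq_abs]
    nlinarith
  have hint : ∀ a b, IntervalIntegrable η volume a b := fun a b ↦
    hη.continuous.intervalIntegrable a b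
  have hint' : ∀ a b, IntervalIntegrable (fun x ↦ 1 - η x) volume a b := fun a b ↦
    (continuous_const.sub hη.continuous).intervalIntegrable a b
  let ψ : ℝ → ℝ := fun s ↦ ∫ x in (0 : ℝ)..s, η x
  have hder : deriv ψ = η := funext fun s ↦ hη.continuous.deriv_integral η 0 s
  have hsub : ∀ s, s - ψ s = ∫ x in (0 : ℝ)..s, (1 - η x) := by
    intro s
    rw [intervalIntegral.integral_sub intervalIntegrable_const (hint 0 s)]
    simp [ψ]
  have hle : ∀ s, |s - ψ s| ≤ |s| := by
    intro s
    rw [hsub]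
    have := intervalIntegral.norm_integral_le_of_norm_le_const (a := 0) (b := s) (C := 1)
      (f := fun x ↦ 1 - η x) fun x _ ↦ by
        rw [Real.norm_eq_abs, abs_le]; constructor <;> linarith [hη0 x, hη1 x]
    simpa using this
  -- Beyond `±3t` the integrand `1 - η` vanishes, so `s - ψ s` stays at its value at `±3t`.
  have hconst : ∀ a s, |a| = 3 * t → (∀ x ∈ uIoc a s, 3 * t ≤ |x|) → |s - ψ s| ≤ 3 * t := by
    intro a s ha h
    have h0 : ∫ x in a..s, (1 - η x) = 0 :=
      intervalIntegral.integral_zero_ae (Eventually.of_forall fun x hx ↦ by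
        rw [hηo x (h x hx), sub_self])
    rw [hsub, ← intervalIntegral.integral_add_adjacent_intervals (hint' 0 a) (hint' a s), h0,
      add_zero, ← hsub, ← ha]
    exact hle a
  refine ⟨ψ, ?_, fun s ↦ ?_, fun s hs ↦ ?_, fun s ↦ ?_, hle, fun s ↦ ?_⟩
  · refine contDiff_infty_iff_deriv.2 ⟨fun s ↦ ?_, by rw [hder]; exact hη⟩
    exact (intervalIntegral.integral_hasDerivAt_right (hint 0 s)
      hη.continuous.stronglyMeasurable.stronglyMeasurableAtFilter
      hη.continuous.continuousAt).differentiableAt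
  · rw [hder, abs_of_nonneg (hη0 s)]
    exact hη1 s
  · refine intervalIntegral.integral_zero_ae (Eventually.of_forall fun x hx ↦ hηz x ?_)
    have hx' := uIoc_subset_uIcc hx
    have := abs_sub_left_of_mem_uIcc hx'
    simp only [sub_zero] at this
    exact this.trans hs
  · have := intervalIntegral.norm_integral_le_of_norm_le_const (a := 0) (b := s) (C := 1)
      (f := η) fun x _ ↦ by
        rw [Real.norm_eq_abs, abs_le]; constructor <;> linarith [hη0 x, hη1 x]
    simpa using this
  · rcases le_or_gt |s| (3 * t) with h | h
    · exact (hle s).trans h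
    rcases lt_abs.1 h with h | h
    · refine hconst (3 * t) s (abs_of_pos (by positivity)) fun x hx ↦ ?_
      rw [uIoc_of_le h.le] at hx
      exact hx.1.le.trans (le_abs_self x)
    · refine hconst (-(3 * t)) s (by rw [abs_neg, abs_of_pos (by positivity)]) fun x hx ↦ ?_
      rw [uIoc_of_ge (by linarith)] at hx
      exact le_trans (by linarith [hx.2]) (neg_le_abs x)

/-- A function bounded by `|f|` and by a multiple of `‖f‖_p` has a `q`-norm controlled by the
`p`-norm of `f`. -/
theorem eLpNorm_le_of_enorm_le {Ω : Type*} [MeasurableSpace Ω] {μ : Measure Ω} {f w : Ω → ℝ}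
    {p q : ℝ} (hp : 0 < p) (hpq : p ≤ q) {D : ℝ≥0∞} (hwf : ∀ x, ‖w x‖ₑ ≤ ‖f x‖ₑ)
    (hw : ∀ x, ‖w x‖ₑ ≤ D * eLpNorm f (ENNReal.ofReal p) μ)
    (hN : D * eLpNorm f (ENNReal.ofReal p) μ ≠ ⊤) :
    eLpNorm w (ENNReal.ofReal q) μ ≤ D ^ ((q - p) / q) * eLpNorm f (ENNReal.ofReal p) μ := by
  have hq : 0 < q := hp.trans_le hpq
  have hqp : 0 ≤ q - p := sub_nonneg.2 hpq
  set N := eLpNorm f (ENNReal.ofReal p) μ with hNdef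
  have hNp : ∫⁻ x, ‖f x‖ₑ ^ p ∂μ = N ^ p := by
    rw [hNdef, eLpNorm_eq_lintegral_rpow_enorm_toReal (by simpa) ENNReal.ofReal_ne_top,
      ENNReal.toReal_ofReal hp.le, ← ENNReal.rpow_mul, one_div_mul_cancel hp.ne', ENNReal.rpow_one]
  rw [eLpNorm_eq_lintegral_rpow_enorm_toReal (by simpa) ENNReal.ofReal_ne_top,
    ENNReal.toReal_ofReal hq.le]
  have h1 : ∫⁻ x, ‖w x‖ₑ ^ q ∂μ ≤ D ^ (q - p) * N ^ q := by
    calc ∫⁻ x, ‖w x‖ₑ ^ q ∂μ ≤ ∫⁻ x, (D * N) ^ (q - p) * ‖f x‖ₑ ^ p ∂μ := by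
          refine lintegral_mono fun x ↦ ?_
          have : ‖w x‖ₑ ^ q = ‖w x‖ₑ ^ (q - p) * ‖w x‖ₑ ^ p := by
            rw [← ENNReal.rpow_add_of_nonneg _ _ hqp hp.le, sub_add_cancel]
          rw [this]
          exact mul_le_mul' (ENNReal.rpow_le_rpow (hw x) hqp) (ENNReal.rpow_le_rpow (hwf x) hp.le)
      _ = (D * N) ^ (q - p) * N ^ p := by
          rw [lintegral_const_mul' _ _ (ENNReal.rpow_ne_top_of_nonneg hqp hN), hNp]
      _ = D ^ (q - p) * N ^ q := by
          rw [ENNReal.mul_rpow_of_nonneg _ _ hqp, mul_assoc,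
            ← ENNReal.rpow_add_of_nonneg _ _ hqp hp.le, sub_add_cancel]
  calc (∫⁻ x, ‖w x‖ₑ ^ q ∂μ) ^ (1 / q) ≤ (D ^ (q - p) * N ^ q) ^ (1 / q) :=
        ENNReal.rpow_le_rpow h1 (by positivity)
    _ = D ^ ((q - p) / q) * N := by
        rw [ENNReal.mul_rpow_of_nonneg _ _ (by positivity), ← ENNReal.rpow_mul, ← ENNReal.rpow_mul,
          mul_one_div, mul_one_div_cancel hq.ne', ENNReal.rpow_one]

/-- Fatou's lemma for powers of norms. -/
theorem eLpNorm_rpow_le_of_tendsto {Ω : Type*} [MeasurableSpace Ω] {μ : Measure Ω}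
    {f : ℕ → Ω → ℝ} {g : Ω → ℝ} {q : ℝ≥0∞} {α : ℝ} (hα : 0 < α) {c : ℕ → ℝ≥0∞} {c' : ℝ≥0∞}
    (hf : ∀ k, AEStronglyMeasurable (f k) μ)
    (hfg : ∀ᵐ x ∂μ, Tendsto (fun k ↦ f k x) atTop (𝓝 (g x)))
    (hle : ∀ k, eLpNorm (f k) q μ ^ α ≤ c k) (hc : Tendsto c atTop (𝓝 c')) :
    eLpNorm g q μ ^ α ≤ c' := by
  have h1 : ∀ k, eLpNorm (f k) q μ ≤ c k ^ α⁻¹ := fun k ↦ by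
    rw [ENNReal.le_rpow_inv_iff hα]
    exact hle k
  have h2 : Tendsto (fun k ↦ c k ^ α⁻¹) atTop (𝓝 (c' ^ α⁻¹)) :=
    (ENNReal.continuous_rpow_const.tendsto c').comp hc
  rw [← ENNReal.le_rpow_inv_iff hα]
  calc eLpNorm g q μ ≤ liminf (fun k ↦ eLpNorm (f k) q μ) atTop :=
        Lp.eLpNorm_lim_le_liminf_eLpNorm hf g hfg
    _ ≤ liminf (fun k ↦ c k ^ α⁻¹) atTop := liminf_le_liminf (Eventually.of_forall h1)
    _ = c' ^ α⁻¹ := h2.liminf_eq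

/-- Markov's inequality at the level `‖f‖_p / τ^{1/p}`. -/
theorem measure_lt_enorm_le {Ω : Type*} [MeasurableSpace Ω] {μ : Measure Ω} {f : Ω → ℝ}
    (hf : AEStronglyMeasurable f μ) {p τ : ℝ} (hp : 0 < p) (hτ : 0 < τ)
    (h0 : eLpNorm f (ENNReal.ofReal p) μ ≠ 0) (h1 : eLpNorm f (ENNReal.ofReal p) μ ≠ ⊤) :
    μ {x | ENNReal.ofReal (τ ^ (-(1 / p))) * eLpNorm f (ENNReal.ofReal p) μ < ‖f x‖ₑ} ≤
      ENNReal.ofReal τ := by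
  set N := eLpNorm f (ENNReal.ofReal p) μ
  have hc : 0 < ENNReal.ofReal (τ ^ (-(1 / p))) := ENNReal.ofReal_pos.2 (by positivity)
  have hε0 : ENNReal.ofReal (τ ^ (-(1 / p))) * N ≠ 0 := mul_ne_zero hc.ne' h0
  have hε1 : ENNReal.ofReal (τ ^ (-(1 / p))) * N ≠ ⊤ := ENNReal.mul_ne_top ENNReal.ofReal_ne_top h1
  have h := meas_ge_le_mul_pow_eLpNorm_enorm μ (by simpa) ENNReal.ofReal_ne_top hf hε0
    (fun h ↦ absurd h hε1) (p := ENNReal.ofReal p)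
  have hsub : {x | ENNReal.ofReal (τ ^ (-(1 / p))) * N < ‖f x‖ₑ} ⊆
      {x | ENNReal.ofReal (τ ^ (-(1 / p))) * N ≤ ‖f x‖ₑ} := by
    intro x hx
    rw [mem_ofPred_eq] at hx ⊢
    exact hx.le
  refine (measure_mono hsub).trans (h.trans (le_of_eq ?_))
  rw [ENNReal.toReal_ofReal hp.le, ENNReal.inv_rpow, ENNReal.mul_rpow_of_nonneg _ _ hp.le,
    ENNReal.ofReal_rpow_of_pos (by positivity), ← Real.rpow_mul hτ.le, neg_mul,
    one_div_mul_cancel hp.ne', Real.rpow_neg_one]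
  change (ENNReal.ofReal τ⁻¹ * N ^ p)⁻¹ * N ^ p = _
  have hNp0 : N ^ p ≠ 0 := by simp [ENNReal.rpow_eq_zero_iff, h0, h1]
  have hNp1 : N ^ p ≠ ⊤ := ENNReal.rpow_ne_top_of_nonneg hp.le h1
  rw [ENNReal.mul_inv (Or.inr hNp1) (Or.inr hNp0), mul_assoc, ENNReal.inv_mul_cancel hNp0 hNp1,
    mul_one, ENNReal.ofReal_inv_of_pos hτ, inv_inv]

end

/-! ### From small volumes to the global inequality -/

section

open MeasureTheory Filter

variable {n : ℕ} {M : Type*} [MetricSpace M] [ChartedSpace (EuclideanSpace ℝ (Fin n)) M]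
  [Bundle.RiemannianBundle (fun x : M ↦ TangentSpace (𝓡 n) x)] [MeasurableSpace M]

/-- A smooth function with compact support in `Ω` belongs to `W_0^{1,p}(Ω)`. -/
theorem memW₀_of_contMDiff {Ω : Set M} {p : ℝ} {φ : M → ℝ}
    (hm : AEStronglyMeasurable φ (riemannianVolume n M))
    (hφ : ContMDiff (𝓡 n) 𝓘(ℝ, ℝ) ∞ φ) (hc : HasCompactSupport φ) (hΩ : tsupport φ ⊆ Ω) :
    MemW₀ Ω p φ (differential (n := n) φ) := by
  refine ⟨hm, fun _ ↦ φ, fun _ ↦ ⟨hc, hΩ⟩, fun _ ↦ hφ, fun _ ↦ ?_, ?_, ?_⟩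
  · simp only [sub_self, covectorNorm_zero]
    exact aestronglyMeasurable_const
  · simp only [sub_self, eLpNorm_zero', tendsto_const_nhds_iff]
  · simp only [sub_self, covectorNorm_zero, eLpNorm_zero', tendsto_const_nhds_iff]

/-- The Sobolev inequality for small volumes implies the Sobolev inequality for all smooth functions
with compact support, as one sees by truncating the function at a suitable level. -/
theorem sobolevInequality_of_hasCompactSupport [BorelSpace M] {p q α A B τ : ℝ} (hp : 1 ≤ p)
    (hpq : p < q) (hα : 0 < α) (hα1 : α ≤ 1) (hτ : 0 < τ) (hB : 0 ≤ B)
    (h : ∀ Ω : Set M, IsOpen Ω → riemannianVolume n M Ω ≤ ENNReal.ofReal τ →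
      ∀ (u : M → ℝ) (X : (x : M) → TangentSpace (𝓡 n) x →L[ℝ] ℝ),
        MemW₀ Ω p u X → SobolevInequality p q α A B u X)
    {φ : M → ℝ} (hφ : ContMDiff (𝓡 n) 𝓘(ℝ, ℝ) ∞ φ) (hc : HasCompactSupport φ) :
    SobolevInequality p q α A (B + ((3 * τ ^ (-(1 / p))) ^ ((q - p) / q)) ^ α) φ
      (differential (n := n) φ) := by
  have hp0 : 0 < p := by linarith
  have hq0 : 0 < q := by linarith
  have hmφ : AEStronglyMeasurable φ (riemannianVolume n M) :=
    hφ.continuous.aestronglyMeasurable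
  set D : ℝ := 3 * τ ^ (-(1 / p)) with hD
  have hDpos : 0 < D := by positivity
  have hKpos : 0 < (D ^ ((q - p) / q)) ^ α := by positivity
  unfold SobolevInequality
  set μ := riemannianVolume n M
  set N := eLpNorm φ (ENNReal.ofReal p) μ with hN
  -- The extreme values of `N` are set aside because the level `t` must be finite and positive.
  rcases eq_or_ne N ⊤ with hNt | hNt
  · rw [hNt, ENNReal.top_rpow_of_pos hα, ENNReal.mul_top (ENNReal.ofReal_pos.2 (by positivity)).ne',
      add_top]
    exact le_top
  rcases eq_or_ne N 0 with hN0 | hN0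
  · have h0 : φ =ᵐ[μ] 0 := (eLpNorm_eq_zero_iff hmφ (by simpa using hp0)).1 hN0
    rw [eLpNorm_congr_ae h0, eLpNorm_zero, ENNReal.zero_rpow_of_pos hα]
    exact bot_le
  let t : ℝ := τ ^ (-(1 / p)) * N.toReal
  have hNpos : 0 < N.toReal := ENNReal.toReal_pos hN0 hNt
  have ht : 0 < t := by positivity
  have htN : ENNReal.ofReal t = ENNReal.ofReal (τ ^ (-(1 / p))) * N := by
    rw [ENNReal.ofReal_mul (by positivity), ENNReal.ofReal_toReal hNt]
  obtain ⟨ψ, hψ, hψ', hψ0, hψle, hsub, hsub3⟩ := exists_smooth_truncation ht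
  let Ω : Set M := {x | t < |φ x|}
  have hΩo : IsOpen Ω := isOpen_lt continuous_const hφ.continuous.abs
  have hΩ : μ Ω ≤ ENNReal.ofReal τ := by
    refine le_trans (measure_mono fun x hx ↦ ?_) (measure_lt_enorm_le hmφ hp0 hτ hN0 hNt)
    rw [mem_ofPred_eq, ← htN, ← ofReal_norm, Real.norm_eq_abs]
    exact (ENNReal.ofReal_lt_ofReal_iff (ht.trans hx)).2 hx
  have hψ00 : ψ 0 = 0 := hψ0 0 (by rw [abs_zero]; positivity)
  have hvs : ContMDiff (𝓡 n) 𝓘(ℝ, ℝ) ∞ (ψ ∘ φ) := (contMDiff_iff_contDiff.2 hψ).comp hφ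
  have hvc : HasCompactSupport (ψ ∘ φ) := hc.comp_left hψ00
  -- The gap between the levels `t` and `2t` puts the closed support inside the open set `Ω`.
  have hvΩ : tsupport (ψ ∘ φ) ⊆ Ω := by
    have h1 : tsupport (ψ ∘ φ) ⊆ {x | 2 * t ≤ |φ x|} := by
      refine closure_minimal (fun x hx ↦ ?_) (isClosed_le continuous_const hφ.continuous.abs)
      by_contra hx'
      exact hx (hψ0 _ (le_of_not_ge hx'))
    intro x hx
    have : 2 * t ≤ |φ x| := h1 hx
    exact lt_of_lt_of_le (by linarith) this
  have hmv : AEStronglyMeasurable (ψ ∘ φ) μ := hvs.continuous.aestronglyMeasurable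
  have hS := h Ω hΩo hΩ _ _ (memW₀_of_contMDiff hmv hvs hvc hvΩ)
  unfold SobolevInequality at hS
  have hgrad : eLpNorm (fun x ↦ covectorNorm (differential (n := n) (ψ ∘ φ) x)) (ENNReal.ofReal p) μ
      ≤ eLpNorm (fun x ↦ covectorNorm (differential (n := n) φ x)) (ENNReal.ofReal p) μ := by
    refine eLpNorm_mono_real fun x ↦ ?_
    rw [Real.norm_of_nonneg (covectorNorm_nonneg _), differential_comp
      (hψ.differentiable (by simp) _) (hφ.mdifferentiableAt (by simp))]
    exact (covectorNorm_smul_le _ _).trans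
      (mul_le_of_le_one_left (covectorNorm_nonneg _) (hψ' _))
  have hvN : eLpNorm (ψ ∘ φ) (ENNReal.ofReal p) μ ≤ N := eLpNorm_mono fun x ↦ hψle (φ x)
  have hw : eLpNorm (φ - ψ ∘ φ) (ENNReal.ofReal q) μ ≤
      ENNReal.ofReal D ^ ((q - p) / q) * N := by
    refine eLpNorm_le_of_enorm_le hp0 hpq.le (fun x ↦ ?_) (fun x ↦ ?_)
      (ENNReal.mul_ne_top ENNReal.ofReal_ne_top hNt)
    · exact enorm_le_iff_norm_le.2 (hsub (φ x))
    · rw [← ofReal_norm]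
      calc ENNReal.ofReal ‖(φ - ψ ∘ φ) x‖ ≤ ENNReal.ofReal (D * N.toReal) :=
            ENNReal.ofReal_le_ofReal ((hsub3 (φ x)).trans_eq (by simp only [t, hD]; ring))
        _ = ENNReal.ofReal D * N := by rw [ENNReal.ofReal_mul hDpos.le, ENNReal.ofReal_toReal hNt]
  have htri : eLpNorm φ (ENNReal.ofReal q) μ ≤ eLpNorm (ψ ∘ φ) (ENNReal.ofReal q) μ +
      eLpNorm (φ - ψ ∘ φ) (ENNReal.ofReal q) μ := by
    have := eLpNorm_add_le hmv (hmφ.sub hmv) (p := ENNReal.ofReal q)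
      (ENNReal.one_le_ofReal.2 (by linarith))
    rwa [add_sub_cancel] at this
  have hK : ENNReal.ofReal ((D ^ ((q - p) / q)) ^ α) = (ENNReal.ofReal D ^ ((q - p) / q)) ^ α := by
    rw [ENNReal.ofReal_rpow_of_pos hDpos, ENNReal.ofReal_rpow_of_pos (by positivity)]
  rw [ENNReal.ofReal_add hB hKpos.le, hK, add_mul, ← add_assoc]
  calc eLpNorm φ (ENNReal.ofReal q) μ ^ α
      ≤ (eLpNorm (ψ ∘ φ) (ENNReal.ofReal q) μ + eLpNorm (φ - ψ ∘ φ) (ENNReal.ofReal q) μ) ^ α :=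
        ENNReal.rpow_le_rpow htri hα.le
    _ ≤ eLpNorm (ψ ∘ φ) (ENNReal.ofReal q) μ ^ α + eLpNorm (φ - ψ ∘ φ) (ENNReal.ofReal q) μ ^ α :=
        -- Subadditivity of the power `α ≤ 1` is what preserves the constant `A`.
        ENNReal.rpow_add_le_add_rpow _ _ hα.le hα1
    _ ≤ _ := by
        refine add_le_add (hS.trans (add_le_add ?_ ?_)) ?_
        · gcongr
        · gcongr
        · rw [← ENNReal.mul_rpow_of_nonneg _ _ hα.le]
          exact ENNReal.rpow_le_rpow hw hα.le

/-- On a complete manifold, a Sobolev inequality for compactly supported smooth functions extends to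
all smooth functions with finite norms. -/
theorem sobolevInequality_of_forall_hasCompactSupport [BorelSpace M] [CompleteSpace M]
    [IsManifold (𝓡 n) ∞ M] [IsRiemannianManifold (𝓡 n) M]
    [IsContinuousRiemannianBundle (EuclideanSpace ℝ (Fin n)) (fun x : M ↦ TangentSpace (𝓡 n) x)]
    {p q α A B : ℝ} (hp : 1 ≤ p) (hα : 0 < α)
    (h : ∀ φ : M → ℝ, ContMDiff (𝓡 n) 𝓘(ℝ, ℝ) ∞ φ → HasCompactSupport φ →
      SobolevInequality p q α A B φ (differential (n := n) φ))
    {φ : M → ℝ} (hφ : ContMDiff (𝓡 n) 𝓘(ℝ, ℝ) ∞ φ)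
    (hφp : MemLp φ (ENNReal.ofReal p) (riemannianVolume n M))
    (hdφ : MemLp (fun x ↦ covectorNorm (differential (n := n) φ x)) (ENNReal.ofReal p)
      (riemannianVolume n M)) :
    SobolevInequality p q α A B φ (differential (n := n) φ) := by
  rcases isEmpty_or_nonempty M with hM | ⟨⟨x₀⟩⟩
  · have : riemannianVolume n M = 0 := Measure.eq_zero_of_isEmpty _
    simp [SobolevInequality, this, hα]
  choose χ hχs hχc hχ1 hχlow hχd using exists_cutoff (n := n) x₀
  set μ := riemannianVolume n M
  have hχlim : ∀ x, Tendsto (fun k ↦ χ k x) atTop (𝓝 1) := by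
    intro x
    refine tendsto_of_tendsto_of_tendsto_of_le_of_le
      (g := fun k : ℕ ↦ 1 - (dist x x₀ + 2) / (k + 1))
      ?_ tendsto_const_nhds (fun k ↦ hχlow k x) fun k ↦ (le_abs_self _).trans (hχ1 k x)
    have := (tendsto_const_div_atTop_nhds_zero_nat (dist x x₀ + 2)).comp (tendsto_add_atTop_nat 1)
    simpa using (tendsto_const_nhds (x := (1 : ℝ))).sub this
  -- The product rule gives `‖d(χ k φ)‖_p ≤ ‖dφ‖_p + 5/(k+1) ‖φ‖_p`, and the last term tends to
  -- zero.
  refine eLpNorm_rpow_le_of_tendsto hα (f := fun k ↦ χ k * φ)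
    (c := fun k ↦ ENNReal.ofReal A *
      (eLpNorm (fun x ↦ covectorNorm (differential (n := n) φ x)) (ENNReal.ofReal p) μ +
        ENNReal.ofReal (5 / (k + 1)) * eLpNorm φ (ENNReal.ofReal p) μ) ^ α +
      ENNReal.ofReal B * eLpNorm φ (ENNReal.ofReal p) μ ^ α)
    (fun k ↦ ((hχs k).continuous.mul hφ.continuous).aestronglyMeasurable)
    (Eventually.of_forall fun x ↦ ?_) (fun k ↦ ?_) ?_
  · simpa using (hχlim x).mul_const (φ x)
  · refine (h _ ((hχs k).mul hφ) ((hχc k).mul_right)).trans (add_le_add ?_ ?_)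
    · refine mul_le_mul_right (ENNReal.rpow_le_rpow ?_ hα.le) _
      have hk : (0 : ℝ) ≤ 5 / (k + 1) := by positivity
      have h1 : eLpNorm (fun x ↦ covectorNorm (differential (n := n) (χ k * φ) x))
          (ENNReal.ofReal p) μ ≤ eLpNorm ((fun x ↦ covectorNorm (differential (n := n) φ x)) +
            (5 / (k + 1) : ℝ) • fun x ↦ |φ x|) (ENNReal.ofReal p) μ := by
        refine eLpNorm_mono_real fun x ↦ ?_
        rw [Real.norm_of_nonneg (covectorNorm_nonneg _), differential_mul
          ((hχs k).mdifferentiableAt (by simp)) (hφ.mdifferentiableAt (by simp))]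
        refine (covectorNorm_add_le _ _).trans (add_le_add ?_ ?_)
        · exact (covectorNorm_smul_le _ _).trans
            (mul_le_of_le_one_left (covectorNorm_nonneg _) (hχ1 k x))
        · refine (covectorNorm_smul_le _ _).trans ?_
          rw [Pi.smul_apply, smul_eq_mul, mul_comm]
          exact mul_le_mul_of_nonneg_right (hχd k x) (abs_nonneg _)
      refine h1.trans ((eLpNorm_add_le hdφ.1 (hφp.1.norm.const_smul _)
        (ENNReal.one_le_ofReal.2 hp)).trans (add_le_add le_rfl ?_))
      rw [eLpNorm_const_smul, Real.enorm_eq_ofReal hk]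
      exact mul_le_mul_right (eLpNorm_norm φ).le _
    · refine mul_le_mul_right (ENNReal.rpow_le_rpow (eLpNorm_mono fun x ↦ ?_) hα.le) _
      rw [Pi.mul_apply, norm_mul]
      exact mul_le_of_le_one_left (norm_nonneg _) (hχ1 k x)
  · refine Tendsto.add (ENNReal.Tendsto.const_mul ?_ (Or.inr ENNReal.ofReal_ne_top))
      tendsto_const_nhds
    refine (ENNReal.continuous_rpow_const.tendsto _).comp ?_
    have h1 : Tendsto (fun k : ℕ ↦ ENNReal.ofReal (5 / (k + 1))) atTop (𝓝 0) := by
      have := (tendsto_const_div_atTop_nhds_zero_nat (5 : ℝ)).comp (tendsto_add_atTop_nat 1)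
      have := ENNReal.tendsto_ofReal this
      simpa using this
    have h2 := ENNReal.Tendsto.mul_const h1 (Or.inr hφp.2.ne)
    simpa using tendsto_const_nhds.add h2

/-- A Sobolev inequality for smooth functions with finite norms extends to `W^{1,p}(M)`. -/
theorem sobolevInequality_of_memW {p q α A B : ℝ} (hp : 1 ≤ p) (hα : 0 < α)
    (h : ∀ φ : M → ℝ, ContMDiff (𝓡 n) 𝓘(ℝ, ℝ) ∞ φ →
      MemLp φ (ENNReal.ofReal p) (riemannianVolume n M) →
      MemLp (fun x ↦ covectorNorm (differential (n := n) φ x)) (ENNReal.ofReal p)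
        (riemannianVolume n M) → SobolevInequality p q α A B φ (differential (n := n) φ))
    {u : M → ℝ} {X : (x : M) → TangentSpace (𝓡 n) x →L[ℝ] ℝ} (hu : MemW p u X) :
    SobolevInequality p q α A B u X := by
  obtain ⟨hum, φ, hφS, hφ, hXm, hlim, hXlim⟩ := hu
  set μ := riemannianVolume n M
  have hp0 : ENNReal.ofReal p ≠ 0 := by simpa using lt_of_lt_of_le one_pos hp
  have hp1 : 1 ≤ ENNReal.ofReal p := ENNReal.one_le_ofReal.2 hp
  -- Membership in `W^{1,p}` gives measurability of `|dφ j|` and `|X - dφ j|` only; `|X|` is an a.e.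
  -- limit of a subsequence of the `|dφ j|`.
  have hXmeas : AEStronglyMeasurable (fun x ↦ covectorNorm (X x)) μ := by
    have h1 : TendstoInMeasure μ (fun j x ↦ covectorNorm (X x - differential (φ j) x)) atTop
        (fun _ ↦ (0 : ℝ)) :=
      tendstoInMeasure_of_tendsto_eLpNorm hp0 hXm aestronglyMeasurable_const (by
        simpa only [Pi.sub_def, sub_zero] using hXlim)
    obtain ⟨ns, -, hns⟩ := h1.exists_seq_tendsto_ae
    refine aestronglyMeasurable_of_tendsto_ae atTop (fun j ↦ (hφS (ns j)).2.1) ?_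
    filter_upwards [hns] with x hx
    rw [tendsto_iff_norm_sub_tendsto_zero]
    refine squeeze_zero (fun j ↦ norm_nonneg _) (fun j ↦ ?_) hx
    rw [norm_sub_rev]
    exact abs_covectorNorm_sub_le _ _
  have h1 : TendstoInMeasure μ φ atTop u := by
    refine tendstoInMeasure_of_tendsto_eLpNorm hp0 (fun j ↦ (hφS j).1.1) hum ?_
    refine hlim.congr fun j ↦ ?_
    rw [← eLpNorm_neg]
    congr 1
    ext x
    simp
  obtain ⟨ns, hns, hae⟩ := h1.exists_seq_tendsto_ae
  refine eLpNorm_rpow_le_of_tendsto hα (f := fun j ↦ φ (ns j))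
    (c := fun j ↦ ENNReal.ofReal A *
      (eLpNorm (fun x ↦ covectorNorm (X x)) (ENNReal.ofReal p) μ +
        eLpNorm (fun x ↦ covectorNorm (X x - differential (φ (ns j)) x)) (ENNReal.ofReal p) μ) ^ α +
      ENNReal.ofReal B * (eLpNorm u (ENNReal.ofReal p) μ +
        eLpNorm (fun x ↦ u x - φ (ns j) x) (ENNReal.ofReal p) μ) ^ α)
    (fun j ↦ (hφS (ns j)).1.1) hae (fun j ↦ ?_) ?_
  · refine (h _ (hφ _) (hφS _).1 (hφS _).2).trans (add_le_add ?_ ?_)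
    · refine mul_le_mul_right (ENNReal.rpow_le_rpow ?_ hα.le) _
      refine le_trans (eLpNorm_mono_real fun x ↦ ?_) (eLpNorm_add_le hXmeas (hXm (ns j)) hp1)
      rw [Real.norm_of_nonneg (covectorNorm_nonneg _), Pi.add_apply]
      linarith [(abs_le.1 (abs_covectorNorm_sub_le (X x) (differential (φ (ns j)) x))).1]
    · refine mul_le_mul_right (ENNReal.rpow_le_rpow ?_ hα.le) _
      have h2 := eLpNorm_sub_le hum (hum.sub (hφS (ns j)).1.1) hp1
      rwa [sub_sub_cancel] at h2
  · have t1 := tendsto_const_nhds (x := eLpNorm (fun x ↦ covectorNorm (X x)) (ENNReal.ofReal p) μ)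
      |>.add (hXlim.comp hns.tendsto_atTop)
    have t2 := tendsto_const_nhds (x := eLpNorm u (ENNReal.ofReal p) μ)
      |>.add (hlim.comp hns.tendsto_atTop)
    rw [add_zero] at t1 t2
    exact Tendsto.add
      (ENNReal.Tendsto.const_mul ((ENNReal.continuous_rpow_const.tendsto _).comp t1)
        (Or.inr ENNReal.ofReal_ne_top))
      (ENNReal.Tendsto.const_mul ((ENNReal.continuous_rpow_const.tendsto _).comp t2)
        (Or.inr ENNReal.ofReal_ne_top))

end

end RiemannianSobolev

end

theorem theorem6p1 {n : ℕ} (hn : 2 ≤ n) {M : Type*} [MetricSpace M] [CompleteSpace M]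
    [SecondCountableTopology M] [MeasurableSpace M] [BorelSpace M]
    [ChartedSpace (EuclideanSpace ℝ (Fin n)) M] [IsManifold (𝓡 n) ∞ M]
    [Bundle.RiemannianBundle (fun x : M ↦ TangentSpace (𝓡 n) x)]
    [IsContMDiffRiemannianBundle (𝓡 n) ∞ (EuclideanSpace ℝ (Fin n))
      (fun x : M ↦ TangentSpace (𝓡 n) x)]
    [IsRiemannianManifold (𝓡 n) M]
    (p q α A : ℝ) (hp : 1 ≤ p) (hpn : p < n) (hq : q = n * p / (n - p))
    (hα : 0 < α) (hα1 : α ≤ 1) (hA : 0 < A)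
    (h : RiemannianSobolev.SobolevForSmallVolumes n M p q α A) :
    RiemannianSobolev.SobolevGlobally n M p q α A := by
  have : IsContinuousRiemannianBundle (EuclideanSpace ℝ (Fin n))
      (fun x : M ↦ TangentSpace (𝓡 n) x) :=
    RiemannianSobolev.isContinuousRiemannianBundle_of_isContMDiffRiemannianBundle
  obtain ⟨τ, hτ, B, hB, h⟩ := h
  have hpq : p < q := by
    rw [hq, lt_div_iff₀ (by linarith)]
    nlinarith
  -- The increase of `B` is the `α`-th power of the constant in the estimate of the truncation
  -- remainder.
  refine ⟨B + ((3 * τ ^ (-(1 / p))) ^ ((q - p) / q)) ^ α, by positivity, fun u X hu ↦ ?_⟩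
  refine RiemannianSobolev.sobolevInequality_of_memW hp hα (fun φ hφ hφp hdφ ↦ ?_) hu
  exact RiemannianSobolev.sobolevInequality_of_forall_hasCompactSupport hp hα
    (fun φ hφ hc ↦ RiemannianSobolev.sobolevInequality_of_hasCompactSupport hp hpq hα hα1 hτ hB h
      hφ hc) hφ hφp hdφ
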